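/- Let $\Sigma=\{0,1\}$, and let $\langle\cdot,\cdot\rangle$ denote a standard injective coding of pairs of strings as strings. An equivalence relation $R$ on $\Sigma^*$ belongs to $\mathsf{PEq}$ if $\{\langle x,y\rangle : x\sim_R y\}$ is decidable in deterministic polynomial time. It belongs to $\mathsf{CF}$ if it has a canonical form computable in polynomial time, that is, a total polynomial-time computable function $f:\Sigma^*\to\Sigma^*$ such that $x\sim_R f(x)$ for all $x$, and $x\sim_R y$ implies $f(x)=f(y)$. Let $\mathsf{NP}$, $\mathsf{RP}$ and $\mathsf{BPP}$ be the usual classes of languages over $\Sigma$. Let $\mathsf{UP}$ be the class of languages accepted by a nondeterministic polynomial-time machine that has at most one accepting path on each input; equivalently, of the languages $L$ for which there are $V\in\mathsf{P}$ and a polynomial $p$ such that $x\in L$ if and only if there is a $y$ with $|y|\le p(|x|)$ and $\langle x,y\rangle\in V$, and such that for every $x$ there is at most one such $y$. Let $\mathsf{PH}=\bigcup_{k\ge 0}\Sigma_k\mathsf{P}$ be the polynomial hierarchy. **Corollary.** If $\mathsf{CF}=\mathsf{PEq}$, then $\mathsf{NP}=\mathsf{UP}=\mathsf{RP}$ and,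 in particular, $\mathsf{PH}=\mathsf{BPP}$. -/

import Mathlib

namespace PolyEq

/-- Strings over the binary alphabet `Σ = {0, 1}`. -/
abbrev Str : Type := List Bool

/-- A decision problem: a set of strings. -/
abbrev Lang : Type := Set Str

/-- The string coding the ordered pair `(x, y)`: every bit of `x` is doubled, then comes the
separator `01`, then `y`. -/
def pair (x y : Str) : Str := x.flatMap (fun b => [b, b]) ++ false :: true :: y

/-- The coding of pairs is injective. -/
theorem pair_inj {x y x' y' : Str} : pair x y = pair x' y' ↔ x = x' ∧ y = y' := by
  constructor
  · induction x generalizing x' with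
    | nil => cases x' <;> simp [pair]; grind
    | cons a t ih =>
      cases x' with
      | nil => simp [pair]; grind
      | cons a' t' =>
        intro h
        simp only [pair, List.flatMap_cons, List.cons_append, List.nil_append,
          List.cons.injEq] at h
        obtain ⟨h1, -, h2⟩ := h
        obtain ⟨h3, h4⟩ := ih (x' := t') h2
        exact ⟨by rw [h1, h3], h4⟩
  · rintro ⟨rfl, rfl⟩; rfl

/-- `FP`: total functions on strings computed by a (multi-tape) Turing transducer in time
polynomial in the length of the input. -/
def FP : Set (Str → Str) :=
  {f | Nonempty (Turing.TM2ComputableInPolyTime id id f)}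

/-- `P`: languages whose characteristic function is computed by a Turing machine in polynomial
time, the answer being written as the one-letter string `0` or `1`. -/
def P : Set Lang :=
  {L | ∃ χ : Str → Bool,
    Nonempty (Turing.TM2ComputableInPolyTime id Computability.encodeBool χ) ∧
      ∀ x, x ∈ L ↔ χ x = true}

/-- `PEq`: equivalence relations on strings whose recognition problem is in `P`. -/
def PEq : Set (Setoid Str) :=
  {R | ∃ D ∈ P, ∀ x y, pair x y ∈ D ↔ R x y}

/-- `f` is a canonical form for `R`: it chooses one representative in each class. -/
def IsCanonicalForm (R : Setoid Str) (f : Str → Str) : Prop :=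
  (∀ x, R x (f x)) ∧ ∀ x y, R x y → f x = f y

/-- `CF`: equivalence relations on strings that have a canonical form in `FP`. -/
def CF : Set (Setoid Str) :=
  {R | ∃ f ∈ FP, IsCanonicalForm R f}

/-- `y` is a string of length at most `p(|x|)` that the verifier `V` accepts together with `x`.
Such strings are the accepting paths, on input `x`, of the nondeterministic machine that guesses
a string `y` of length at most `p(|x|)` and then decides deterministically if `(x, y) ∈ V`. -/
def Witness (V : Lang) (p : Polynomial ℕ) (x y : Str) : Prop :=
  y.length ≤ p.eval x.length ∧ pair x y ∈ V

/-- `NP`: membership is equivalent to having a witness. -/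
def NP : Set Lang :=
  {L | ∃ V ∈ P, ∃ p : Polynomial ℕ, ∀ x, x ∈ L ↔ ∃ y, Witness V p x y}

/-- `UP`: as `NP`, with at most one witness (accepting path) on each input. -/
def UP : Set Lang :=
  {L | ∃ V ∈ P, ∃ p : Polynomial ℕ, ∀ x,
    (x ∈ L ↔ ∃ y, Witness V p x y) ∧
      ∀ y y', Witness V p x y → Witness V p x y' → y = y'}

/-- The probability that `V` accepts `(x, r)`, for `r` uniformly random in `{0, 1}^n`. -/
noncomputable def acceptProb (V : Lang) (n : ℕ) (x : Str) : ℚ :=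
  ({r : Str | r.length = n ∧ pair x r ∈ V}.ncard : ℚ) / 2 ^ n

/-- `RP`: probabilistic polynomial time with one-sided error. -/
def RP : Set Lang :=
  {L | ∃ V ∈ P, ∃ p : Polynomial ℕ, ∀ x,
    (x ∈ L → 1 / 2 ≤ acceptProb V (p.eval x.length) x) ∧
      (x ∉ L → acceptProb V (p.eval x.length) x = 0)}

/-- `BPP`: probabilistic polynomial time with two-sided bounded error. -/
def BPP : Set Lang :=
  {L | ∃ V ∈ P, ∃ p : Polynomial ℕ, ∀ x,
    (x ∈ L → 2 / 3 ≤ acceptProb V (p.eval x.length) x) ∧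
      (x ∉ L → acceptProb V (p.eval x.length) x ≤ 1 / 3)}

/-- `Σₖ P`: `Σ₀ P = P`, and `Σₖ₊₁ P` consists of the languages obtained by polynomially bounded
existential quantification over a language in `Πₖ P`, the class of complements of the languages
in `Σₖ P`. -/
def SigmaP : ℕ → Set Lang
  | 0 => P
  | k + 1 => {L | ∃ V : Lang, Vᶜ ∈ SigmaP k ∧ ∃ p : Polynomial ℕ,
      ∀ x, x ∈ L ↔ ∃ y, Witness V p x y}

/-- `PH`: the polynomial hierarchy, the union of the classes `Σₖ P`. -/
def PH : Set Lang := ⋃ k, SigmaP k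

end PolyEq

/-!
The theorem rests on two uses of canonical forms. Let `L` be in `NP`. Pairs `(x, y)`, `(x, y')` of
an input and a witness for it are identified by an equivalence relation in `PEq`; a canonical form
selects one witness for each `x ∈ L`, and a verifier that accepts only this one shows that `L` is
in `UP` (`NP_subset_UP`). Let `L` be in `UP`, and pad witnesses to nonzero strings `d` of a fixed
length. For an input `x`, the strings `u` and `u ⊕ d`, where `d` is the padded witness, are
identified by a relation in `PEq`; it is transitive because there is at most one `d`. A random `u`
differs from its canonical form with probability one half if `x ∈ L`, and never otherwise, so `L`
is in `RP` (`UP_subset_RP`). As `RP ⊆ NP`, the three classes are equal.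

Therefore `NP ⊆ BPP`, and `PH ⊆ BPP` follows by induction on the level: the error of a `BPP`
machine is made so small (`exists_amplified`) that most random strings are right about all
candidates for a witness at the same time, which turns the existence of a witness into a question
in `NP` (`exists_mem_BPP`). The converse `BPP ⊆ Σ₂ P` (`BPP_subset_SigmaP_two`) is the theorem of
Sipser, Gács and Lautemann. It is proved here with the majority vote over random shifts, so that
the same Chernoff bound `cnt_blockCount_le` serves for amplification and for this inclusion.

Polynomial-time computability has to be developed from the definition of stack machines.
Program fragments (`Frag`) with sequencing, loops, finite-state transfer between stacks and calls of
given machines as subroutines are composed into machines, with bounds for their running time. From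
them come four closure properties of the class `PolyTime` of functions between encoded types:
composition (`PolyTime.comp`), pairing (`PolyTime.pair`), finite-state transducers
(`PolyTime.of_transducer`), and iteration with results of bounded length (`PolyTime.iterate_size`).
All other functions are obtained from these without mention of machines.
-/

namespace PolyEq

open Turing Function

/-! ### Structured programs for stack machines -/

/-- `Reach f t a b`: iterating the partial step function `f` leads from `a` to `b` in at most `t`
steps. -/
def Reach {C : Type*} (f : C → Option C) (t : ℕ) (a b : C) : Prop :=
  ∃ s ≤ t, (flip bind f)^[s] (some a) = some b

theorem iterate_bind_none {C : Type*} (f : C → Option C) (s : ℕ) :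
    (flip bind f)^[s] none = none := by
  induction s with
  | zero => rfl
  | succ s ih => rw [iterate_succ_apply]; exact ih

namespace Reach

variable {C : Type*} {f : C → Option C} {t u : ℕ} {a b c : C}

theorem refl : Reach f 0 a a := ⟨0, le_rfl, rfl⟩

theorem mono (h : Reach f t a b) (htu : t ≤ u) : Reach f u a b :=
  let ⟨s, hs, e⟩ := h; ⟨s, hs.trans htu, e⟩

theorem trans (h : Reach f t a b) (h' : Reach f u b c) : Reach f (t + u) a c := by
  obtain ⟨s, hs, e⟩ := h
  obtain ⟨s', hs', e'⟩ := h'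
  exact ⟨s' + s, by omega, by rw [iterate_add_apply, e, e']⟩

theorem single (h : f a = some b) : Reach f 1 a b := ⟨1, le_rfl, h⟩

theorem head (h : f a = some b) (h' : Reach f t b c) : Reach f (t + 1) a c :=
  ((single h).trans h').mono (by omega)

/-- A forward simulation carries runs over. -/
theorem simulate {C' : Type*} {f' : C' → Option C'} {R : C → C' → Prop}
    (hR : ∀ a b a', R a a' → f a = some b → ∃ b', f' a' = some b' ∧ R b b')
    (h : Reach f t a b) {a' : C'} (ha : R a a') : ∃ b', R b b' ∧ Reach f' t a' b' := by
  obtain ⟨s, hs, e⟩ := h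
  suffices ∃ b', R b b' ∧ Reach f' s a' b' from
    let ⟨b', h1, h2⟩ := this; ⟨b', h1, h2.mono hs⟩
  clear hs
  induction s generalizing a a' with
  | zero => cases e; exact ⟨a', ha, refl⟩
  | succ s ih =>
    rw [iterate_succ_apply] at e
    cases hfa : f a with
    | none =>
      have : flip bind f (some a) = none := hfa
      rw [this, iterate_bind_none] at e
      cases e
    | some a₁ =>
      have : flip bind f (some a) = some a₁ := hfa
      rw [this] at e
      obtain ⟨a₁', h1, h2⟩ := hR _ _ _ ha hfa
      obtain ⟨b', h3, h4⟩ := ih h2 e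
      exact ⟨b', h3, head h1 h4⟩

end Reach

/-- A program fragment for a machine with stacks `Γ` and local variables `σ`: finitely many labels,
an entry point, and code that is generic in the label type of the surrounding machine, in the
placement of the labels of the fragment, and in the label at which control leaves it. -/
structure Frag {K : Type} (Γ : K → Type) (σ : Type) where
  /-- the labels of the fragment -/
  Lab : Type
  /-- there are finitely many of them -/
  fin : Fintype Lab
  /-- the label at which control enters -/
  entry : Lab
  /-- the statement at each label -/
  code : ∀ {Λ : Type}, (Lab → Λ) → Λ → Lab → TM2.Stmt Γ Λ σ

namespace Frag

variable {K : Type} [DecidableEq K] {Γ : K → Type} {σ : Type}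

/-- `F.Runs v S S' t`: in any machine that contains `F`, entering `F` with variables `v` and stacks
`S` leads in at most `t` steps to the exit with variables `v` again and stacks `S'`. -/
def Runs (F : Frag Γ σ) (v : σ) (S S' : ∀ k, List (Γ k)) (t : ℕ) : Prop :=
  ∀ ⦃Λ : Type⦄ (m : Λ → TM2.Stmt Γ Λ σ) (emb : F.Lab → Λ) (exit : Λ),
    (∀ l, m (emb l) = F.code emb exit l) →
      Reach (TM2.step m) t ⟨some (emb F.entry), v, S⟩ ⟨some exit, v, S'⟩

theorem Runs.mono {F : Frag Γ σ} {v : σ} {S S' : ∀ k, List (Γ k)} {t u : ℕ}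
    (h : F.Runs v S S' t) (htu : t ≤ u) : F.Runs v S S' u :=
  fun _ m emb exit hm => (h m emb exit hm).mono htu

/-- Sequential composition. -/
def seq (F G : Frag Γ σ) : Frag Γ σ where
  Lab := F.Lab ⊕ G.Lab
  fin := by have := F.fin; have := G.fin; infer_instance
  entry := .inl F.entry
  code emb exit
    | .inl l => F.code (emb ∘ .inl) (emb (.inr G.entry)) l
    | .inr l => G.code (emb ∘ .inr) exit l

theorem Runs.seq {F G : Frag Γ σ} {v : σ} {S S' S'' : ∀ k, List (Γ k)} {t u : ℕ}
    (hF : F.Runs v S S' t) (hG : G.Runs v S' S'' u) : (F.seq G).Runs v S S'' (t + u) :=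
  fun _ m emb exit hm =>
    (hF m (emb ∘ .inl) (emb (.inr G.entry)) fun l => hm (.inl l)).trans
      (hG m (emb ∘ .inr) exit fun l => hm (.inr l))

/-- The code that pushes a list of symbols, the first one first. -/
def pushCode {Λ : Type} : List (Σ k, Γ k) → TM2.Stmt Γ Λ σ → TM2.Stmt Γ Λ σ
  | [], q => q
  | p :: l, q => .push p.1 (fun _ => p.2) (pushCode l q)

/-- The effect of pushing a list of symbols, the first one first. -/
def pushAll : List (Σ k, Γ k) → (∀ k, List (Γ k)) → ∀ k, List (Γ k)
  | [], S => S
  | p :: l, S => pushAll l (update S p.1 (p.2 :: S p.1))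

theorem stepAux_pushCode {Λ : Type} (l : List (Σ k, Γ k)) (q : TM2.Stmt Γ Λ σ) (v : σ)
    (S : ∀ k, List (Γ k)) :
    TM2.stepAux (pushCode l q) v S = TM2.stepAux q v (pushAll l S) := by
  induction l generalizing S with
  | nil => rfl
  | cons p l ih => exact ih _

theorem pushAll_append (l l' : List (Σ k, Γ k)) (S : ∀ k, List (Γ k)) :
    pushAll (l ++ l') S = pushAll l' (pushAll l S) := by
  induction l generalizing S with
  | nil => rfl
  | cons p l ih => exact ih _

theorem pushAll_update (l : List (Σ k, Γ k)) (S : ∀ k, List (Γ k)) {a : K}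
    (ha : ∀ p ∈ l, p.1 ≠ a) (x : List (Γ a)) :
    pushAll l (update S a x) = update (pushAll l S) a x := by
  induction l generalizing S with
  | nil => rfl
  | cons p l ih =>
    have hp : p.1 ≠ a := ha p (by simp)
    rw [pushAll, pushAll, update_of_ne hp, update_comm hp.symm,
      ih _ fun p hp => ha p (by simp [hp])]

theorem pushAll_of_ne (l : List (Σ k, Γ k)) (S : ∀ k, List (Γ k)) {a : K}
    (ha : ∀ p ∈ l, p.1 ≠ a) : pushAll l S a = S a := by
  rw [← update_eq_self a S, pushAll_update l S ha]; simp

theorem pushAll_single {A : Type} (k : K) (e : A → Γ k) (l : List A) (S : ∀ k, List (Γ k)) :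
    pushAll (l.map fun x => (⟨k, e x⟩ : Σ k, Γ k)) S =
      update S k ((l.map e).reverse ++ S k) := by
  induction l generalizing S with
  | nil => simp [pushAll]
  | cons x l ih => simp [pushAll, ih]

/-- Push a fixed list of symbols. -/
def push (ps : List (Σ k, Γ k)) : Frag Γ σ where
  Lab := Unit
  fin := inferInstance
  entry := ()
  code _ exit _ := pushCode ps (.goto fun _ => exit)

theorem push_runs (ps : List (Σ k, Γ k)) (v : σ) (S : ∀ k, List (Γ k)) :
    (push ps).Runs v S (pushAll ps S) 1 := by
  intro Λ m emb exit hm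
  apply Reach.single
  rw [TM2.step, hm]
  simp [push, stepAux_pushCode]

variable {τ : Type}

/-- Empty the stack `a` with a finite-state transducer: in the state `q`, popping a symbol that
stands for the bit `b` has the effect that the symbols `(δ q b).2` are pushed, and leads to the
state `(δ q b).1`; when `a` is empty, `last q` is pushed. The popped bit is kept in the first of the
local variables. -/
def fsm (a : K) (dec : Γ a → Bool) {Q : Type} [Fintype Q] (q₀ : Q)
    (δ : Q → Bool → Q × List (Σ k, Γ k)) (last : Q → List (Σ k, Γ k)) :
    Frag Γ (Option Bool × τ) where
  Lab := Q
  fin := inferInstance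
  entry := q₀
  code emb exit q :=
    .pop a (fun v o => (o.map dec, v.2)) <|
      .branch (fun v => v.1 = none) (pushCode (last q) (.goto fun _ => exit)) <|
        .branch (fun v => v.1 = some true)
          (pushCode (δ q true).2 (.goto fun _ => emb (δ q true).1))
          (pushCode (δ q false).2 (.goto fun _ => emb (δ q false).1))

/-- All the symbols that `fsm` pushes on a given input. -/
def fsmTrace {Q A : Type} (δ : Q → Bool → Q × List A) (last : Q → List A) : Q → List Bool → List A
  | q, [] => last q
  | q, b :: l => (δ q b).2 ++ fsmTrace δ last (δ q b).1 l

/-- Emptying a stack takes one step for each symbol, and one to notice that the stack is empty. -/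
theorem fsm_runs (a : K) (dec : Γ a → Bool) {Q : Type} [Fintype Q] (q₀ : Q)
    (δ : Q → Bool → Q × List (Σ k, Γ k)) (last : Q → List (Σ k, Γ k))
    (hδ : ∀ q b, ∀ p ∈ (δ q b).2, p.1 ≠ a) (v : τ) (S : ∀ k, List (Γ k)) :
    (fsm a dec q₀ δ last).Runs (none, v) S
      (pushAll (fsmTrace δ last q₀ ((S a).map dec)) (update S a [])) ((S a).length + 1) := by
  intro Λ m emb exit hm
  change ∀ q : Q, _ at hm
  have key : ∀ (l : List (Γ a)) (q : Q) (o : Option Bool) (S : ∀ k, List (Γ k)), S a = l →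
      Reach (TM2.step m) (l.length + 1) ⟨some (emb q), (o, v), S⟩
        ⟨some exit, (none, v), pushAll (fsmTrace δ last q (l.map dec)) (update S a [])⟩ := by
    intro l
    induction l with
    | nil =>
      intro q o S hS
      apply Reach.single
      rw [TM2.step, hm]
      simp [fsm, stepAux_pushCode, hS, fsmTrace]
    | cons x l ih =>
      intro q o S hS
      have h1 : TM2.step m ⟨some (emb q), (o, v), S⟩ = some ⟨some (emb (δ q (dec x)).1),
          (some (dec x), v), pushAll (δ q (dec x)).2 (update S a l)⟩ := by
        rw [TM2.step, hm]
        cases hx : dec x <;> simp [fsm, stepAux_pushCode, hS, hx]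
      have hne := hδ q (dec x)
      refine Reach.head h1 ?_
      have := ih (δ q (dec x)).1 (some (dec x)) (pushAll (δ q (dec x)).2 (update S a l))
        (by rw [pushAll_of_ne _ _ hne]; simp)
      rw [← pushAll_update _ _ hne, update_idem] at this
      simpa [fsmTrace, pushAll_append] using this
  exact key _ q₀ none S rfl

/-- Repeat `F`, popping a symbol from `a` before each round, until `a` is empty. -/
def loop (a : K) (F : Frag Γ (Option Bool × τ)) : Frag Γ (Option Bool × τ) where
  Lab := Option F.Lab
  fin := by have := F.fin; infer_instance
  entry := none
  code emb exit
    | none =>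
      .pop a (fun v o => (o.map fun _ => true, v.2)) <|
        .branch (fun v => v.1 = none) (.goto fun _ => exit) <|
          .load (fun v => (none, v.2)) (.goto fun _ => emb (some F.entry))
    | some l => F.code (emb ∘ some) (emb none) l

theorem loop_runs_nil (a : K) (F : Frag Γ (Option Bool × τ)) (v : τ) (S : ∀ k, List (Γ k))
    (hS : S a = []) : (loop a F).Runs (none, v) S S 1 := by
  intro Λ m emb exit hm
  apply Reach.single
  have := hm none
  change m (emb none) = _ at this
  change TM2.step m ⟨some (emb none), _, _⟩ = _
  have hu : update S a [] = S := by rw [← hS, update_eq_self]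
  rw [TM2.step, this]
  simp [loop, hS, hu]

theorem loop_runs_cons (a : K) (F : Frag Γ (Option Bool × τ)) (v : τ) {S S' S'' : ∀ k, List (Γ k)}
    {x : Γ a} {l : List (Γ a)} {t u : ℕ} (hS : S a = x :: l)
    (hF : F.Runs (none, v) (update S a l) S' t) (hL : (loop a F).Runs (none, v) S' S'' u) :
    (loop a F).Runs (none, v) S S'' (1 + t + u) := by
  intro Λ m emb exit hm
  have h1 : TM2.step m ⟨some (emb none), (none, v), S⟩ =
      some ⟨some (emb (some F.entry)), (none, v), update S a l⟩ := by
    have := hm none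
    change m (emb none) = _ at this
    rw [TM2.step, this]
    simp [loop, hS]
  exact ((Reach.single h1).trans (hF m (emb ∘ some) (emb none) fun l => hm (some l))).trans
    (hL m emb exit hm)

end Frag

/-- Transport of a statement into a machine with more stacks, via `j`, and more variables, via the
lens `get`, `set`. Halting becomes a jump to `exit`. -/
def liftStmt {K K' : Type} {Γ : K' → Type} {Λ Λ' σ σ' : Type} (j : K → K') (get : σ' → σ)
    (set : σ → σ' → σ') (emb : Λ → Λ') (exit : Λ') :
    TM2.Stmt (fun k => Γ (j k)) Λ σ → TM2.Stmt Γ Λ' σ'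
  | .push k f q => .push (j k) (fun v => f (get v)) (liftStmt j get set emb exit q)
  | .peek k f q => .peek (j k) (fun v o => set (f (get v) o) v) (liftStmt j get set emb exit q)
  | .pop k f q => .pop (j k) (fun v o => set (f (get v) o) v) (liftStmt j get set emb exit q)
  | .load f q => .load (fun v => set (f (get v)) v) (liftStmt j get set emb exit q)
  | .branch f q q' => .branch (fun v => f (get v)) (liftStmt j get set emb exit q)
      (liftStmt j get set emb exit q')
  | .goto f => .goto fun v => emb (f (get v))
  | .halt => .goto fun _ => exit

/-- The configuration `c'` of a larger machine represents the configuration `c`; outside of the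
range of `j` its stacks are those of `S₀`. -/
structure LiftRel {K K' : Type} {Γ : K' → Type} {Λ Λ' σ σ' : Type} (j : K → K')
    (set : σ → σ' → σ') (emb : Λ → Λ') (exit : Λ') (v₀ : σ') (S₀ : ∀ k, List (Γ k))
    (c : TM2.Cfg (fun k => Γ (j k)) Λ σ) (c' : TM2.Cfg Γ Λ' σ') : Prop where
  label : c'.l = some (c.l.elim exit emb)
  var : c'.var = set c.var v₀
  stk : ∀ k, c'.stk (j k) = c.stk k
  rest : ∀ k', (∀ k, j k ≠ k') → c'.stk k' = S₀ k'

/-- The transport of a statement simulates the statement. -/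
theorem liftRel_stepAux {K K' : Type} [DecidableEq K] [DecidableEq K'] {Γ : K' → Type}
    {Λ Λ' σ σ' : Type} {j : K → K'} (hj : Injective j) {get : σ' → σ} {set : σ → σ' → σ'}
    (hgs : ∀ a v, get (set a v) = a) (hss : ∀ a b v, set a (set b v) = set a v)
    (emb : Λ → Λ') (exit : Λ') (v₀ : σ') (S₀ : ∀ k, List (Γ k))
    (q : TM2.Stmt (fun k => Γ (j k)) Λ σ) (v : σ) (S : ∀ k, List (Γ (j k)))
    (S' : ∀ k, List (Γ k)) (h1 : ∀ k, S' (j k) = S k)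
    (h2 : ∀ k', (∀ k, j k ≠ k') → S' k' = S₀ k') :
    LiftRel j set emb exit v₀ S₀ (TM2.stepAux q v S)
      (TM2.stepAux (liftStmt j get set emb exit q) (set v v₀) S') := by
  have hup : ∀ (S : ∀ k, List (Γ (j k))) (S' : ∀ k, List (Γ k)), (∀ k, S' (j k) = S k) →
      ∀ k (x : List (Γ (j k))) k₂, update S' (j k) x (j k₂) = update S k x k₂ := by
    intro S S' h k x k₂
    by_cases hk : k₂ = k
    · subst hk; simp
    · rw [update_of_ne hk, update_of_ne (fun h => hk (hj h)), h]
  have hup' : ∀ (S' : ∀ k, List (Γ k)), (∀ k', (∀ k, j k ≠ k') → S' k' = S₀ k') →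
      ∀ k (x : List (Γ (j k))) k', (∀ k, j k ≠ k') → update S' (j k) x k' = S₀ k' := by
    intro S' h k x k' hk'
    rw [update_of_ne (hk' k).symm, h k' hk']
  induction q generalizing v S S' with
  | push k f q ih =>
    simp only [liftStmt, TM2.stepAux, hgs, h1]
    exact ih _ _ _ (hup _ _ h1 k _) (hup' _ h2 k _)
  | peek k f q ih =>
    simp only [liftStmt, TM2.stepAux, hgs, hss, h1]
    exact ih _ _ _ h1 h2
  | pop k f q ih =>
    simp only [liftStmt, TM2.stepAux, hgs, hss, h1]
    exact ih _ _ _ (hup _ _ h1 k _) (hup' _ h2 k _)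
  | load f q ih =>
    simp only [liftStmt, TM2.stepAux, hgs, hss]
    exact ih _ _ _ h1 h2
  | branch f q q' ih ih' =>
    simp only [liftStmt, TM2.stepAux, hgs]
    cases f v
    · exact ih' _ _ _ h1 h2
    · exact ih _ _ _ h1 h2
  | goto f =>
    simp only [liftStmt, TM2.stepAux, hgs]
    exact ⟨rfl, rfl, h1, h2⟩
  | halt => exact ⟨rfl, rfl, h1, h2⟩

/-- A bound for the number of symbols that a statement pushes on the stack `a`. -/
def pushCount {K : Type} [DecidableEq K] {Γ : K → Type} {Λ σ : Type} (a : K) :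
    TM2.Stmt Γ Λ σ → ℕ
  | .push k _ q => (if k = a then 1 else 0) + pushCount a q
  | .peek _ _ q => pushCount a q
  | .pop _ _ q => pushCount a q
  | .load _ q => pushCount a q
  | .branch _ q q' => pushCount a q + pushCount a q'
  | .goto _ => 0
  | .halt => 0

theorem length_stepAux_le {K : Type} [DecidableEq K] {Γ : K → Type} {Λ σ : Type} (a : K)
    (q : TM2.Stmt Γ Λ σ) (v : σ) (S : ∀ k, List (Γ k)) :
    ((TM2.stepAux q v S).stk a).length ≤ (S a).length + pushCount a q := by
  induction q generalizing v S with
  | push k f q ih =>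
    refine (ih _ _).trans ?_
    by_cases hk : k = a
    · subst hk; simp [pushCount]; omega
    · simp [pushCount, hk, update_of_ne (Ne.symm hk)]
  | peek k f q ih => exact ih _ _
  | pop k f q ih =>
    refine (ih _ _).trans ?_
    by_cases hk : k = a
    · subst hk; simp [pushCount]
    · simp [pushCount, update_of_ne (Ne.symm hk)]
  | load f q ih => exact ih _ _
  | branch f q q' ih ih' =>
    rw [TM2.stepAux, pushCount]
    cases f v
    · exact (ih' _ _).trans (by omega)
    · exact (ih _ _).trans (by omega)
  | goto f => simp [pushCount]
  | halt => simp [pushCount]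

/-- The output of a machine is not longer than its input plus a constant times its running time. -/
theorem exists_length_output_le (tm : FinTM2) : ∃ C : ℕ, ∀ x y t,
    Reach tm.step t (initList tm x) (haltList tm y) → y.length ≤ x.length + C * t := by
  classical
  have := tm.ΛFin
  refine ⟨∑ l, pushCount tm.k₁ (tm.m l), fun x y t ⟨s, hs, h⟩ => ?_⟩
  have key : ∀ (s : ℕ) (c c' : tm.Cfg), (flip bind tm.step)^[s] (some c) = some c' →
      (c'.stk tm.k₁).length ≤ (c.stk tm.k₁).length + (∑ l, pushCount tm.k₁ (tm.m l)) * s := by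
    intro s
    induction s with
    | zero => rintro c c' h; cases h; simp
    | succ s ih =>
      rintro ⟨l, v, S⟩ c' h
      rw [iterate_succ_apply] at h
      cases l with
      | none =>
        have : flip bind tm.step (some ⟨none, v, S⟩) = none := rfl
        rw [this, iterate_bind_none] at h
        cases h
      | some l =>
        have h0 : flip bind tm.step (some ⟨some l, v, S⟩) =
          some (TM2.stepAux (tm.m l) v S) := rfl
        rw [h0] at h
        have h1 := ih _ _ h
        have h2 := length_stepAux_le tm.k₁ (tm.m l) v S
        have h3 : pushCount tm.k₁ (tm.m l) ≤ ∑ l, pushCount tm.k₁ (tm.m l) :=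
          Finset.single_le_sum (f := fun l => pushCount tm.k₁ (tm.m l)) (by simp)
            (Finset.mem_univ l)
        change _ ≤ (S tm.k₁).length + _
        rw [Nat.mul_succ]
        omega
  have h1 := key s _ _ h
  have h2 : (haltList tm y).stk tm.k₁ = y := by simp [haltList]
  have h3 : ((initList tm x).stk tm.k₁).length ≤ x.length := by
    by_cases hk : tm.k₁ = tm.k₀
    · simp only [initList, hk, dite_true]
      rw [show x.length = ((initList tm x).stk tm.k₀).length by simp [initList]]
      simp only [initList, dite_true]
      generalize tm.k₁ = k at hk
      subst hk
      rfl
    · simp [initList, hk]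
  rw [h2] at h1
  calc y.length ≤ _ := h1
    _ ≤ _ := Nat.add_le_add h3 (Nat.mul_le_mul_left _ hs)

/-! ### Machines with registers and subroutines -/

/-- A machine `tm` with alphabets identified with the bits computes the string `y` from the string
`x` in at most `t` steps. -/
def Outputs (tm : FinTM2) (e₀ : tm.Γ tm.k₀ ≃ Bool) (e₁ : tm.Γ tm.k₁ ≃ Bool) (x y : Str)
    (t : ℕ) : Prop :=
  Reach tm.step t (initList tm (x.map e₀.symm)) (haltList tm (y.map e₁.symm))

section Bench

variable {ι X : Type} [DecidableEq ι] [DecidableEq X] (tm : ι → FinTM2)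

/-- The stacks of a machine that has registers `X` and the machines `tm i` as subroutines. -/
abbrev BenchK (X : Type) (tm : ι → FinTM2) : Type := X ⊕ Σ i, (tm i).K

/-- The stack alphabets of a machine with registers and subroutines: registers hold bits. -/
abbrev BenchΓ (X : Type) (tm : ι → FinTM2) : BenchK X tm → Type
  | .inl _ => Bool
  | .inr p => (tm p.1).Γ p.2

/-- The local variables of a machine with registers and subroutines: the bit read last, and the
variables of each subroutine. -/
abbrev Benchσ (tm : ι → FinTM2) : Type := Option Bool × ∀ i, (tm i).σ

/-- The local variables between two commands. -/
abbrev benchInit : Benchσ tm := (none, fun i => (tm i).initialState)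

/-- The stacks between two commands: registers as given, all stacks of subroutines empty. -/
abbrev regs (c : X → Str) : ∀ k, List (BenchΓ X tm k)
  | .inl x => c x
  | .inr _ => []

theorem regs_update (c : X → Str) (r : X) (l : Str) :
    regs tm (update c r l) = update (regs tm c) (.inl r) l := by
  funext k
  rcases k with x | p
  · by_cases hx : x = r
    · subst hx; simp
    · rw [update_of_ne (by simpa using hx)]; simp [hx]
  · simp

namespace Frag

/-- A run between register contents. -/
def RegRuns {tm : ι → FinTM2} (F : Frag (BenchΓ X tm) (Benchσ tm)) (c c' : X → Str) (t : ℕ) :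
    Prop :=
  F.Runs (benchInit tm) (regs tm c) (regs tm c') t

/-- The subroutine `tm i`, working on its own stacks. -/
def runBox (i : ι) : Frag (BenchΓ X tm) (Benchσ tm) where
  Lab := (tm i).Λ
  fin := (tm i).ΛFin
  entry := (tm i).main
  code emb exit l := liftStmt (Γ := BenchΓ X tm) (fun k => .inr ⟨i, k⟩) (fun v => v.2 i)
    (fun a v => (v.1, update v.2 i a)) emb exit ((tm i).m l)

/-- By definition, machines halt with their variables reset and with all stacks empty but the one
for the output. So the stacks of a subroutine are ready for the next call once the output
is removed. -/
theorem runBox_runs (i : ι) {t : ℕ} {x : List ((tm i).Γ (tm i).k₀)}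
    {y : List ((tm i).Γ (tm i).k₁)} (h : Reach (tm i).step t (initList (tm i) x)
      (haltList (tm i) y)) (S : ∀ k, List (BenchΓ X tm k)) (hS : ∀ k, S (.inr ⟨i, k⟩) = []) :
    (runBox tm i).Runs (benchInit tm) (update S (.inr ⟨i, (tm i).k₀⟩) x)
      (update S (.inr ⟨i, (tm i).k₁⟩) y) t := by
  intro Λ m emb exit hm
  have hj : Injective (fun k => .inr ⟨i, k⟩ : (tm i).K → BenchK X tm) := by
    intro a b hab; simpa using hab
  have hup : ∀ (k₁ : (tm i).K) (y : List ((tm i).Γ k₁)) (k : (tm i).K),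
      update S (.inr ⟨i, k₁⟩) y (.inr ⟨i, k⟩) =
        @dite (List ((tm i).Γ k)) (k = k₁) ((tm i).kDecidableEq k k₁)
          (fun h => by rw [h]; exact y) fun _ => [] := by
    intro k₁ y k
    by_cases hk : k = k₁
    · subst hk; simp
    · rw [update_of_ne (by simpa using hk), hS]; simp [hk]
  obtain ⟨b', hb, hr⟩ := h.simulate (f' := TM2.step m)
    (R := LiftRel (Γ := BenchΓ X tm) (fun k => .inr ⟨i, k⟩)
      (fun a v => (v.1, update v.2 i a)) emb exit (benchInit tm) S)
    (a' := ⟨some (emb (tm i).main), benchInit tm, update S (.inr ⟨i, (tm i).k₀⟩) x⟩)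
    (by
      rintro ⟨l, v, T⟩ b ⟨l', v', T'⟩ ⟨h1, h2, h3, h4⟩ hab
      cases l with
      | none => cases hab
      | some l =>
        obtain rfl : TM2.stepAux ((tm i).m l) v T = b := Option.some.inj hab
        obtain rfl : l' = some (emb l) := h1
        subst h2
        have hml : m (emb l) = _ := hm l
        refine ⟨_, rfl, ?_⟩
        rw [hml]
        exact liftRel_stepAux hj (by simp) (by simp) emb exit _ S _ _ _ _ h3 h4)
    ⟨rfl, by simp [initList, benchInit], fun k => hup _ _ k,
      fun k' hk' => update_of_ne (hk' _).symm _ _⟩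
  obtain ⟨l', v', T'⟩ := b'
  obtain ⟨h1, h2, h3, h4⟩ := hb
  obtain rfl : l' = some exit := h1
  obtain rfl : v' = benchInit tm := by
    change v' = _ at h2
    simp [h2, haltList, benchInit]
  obtain rfl : T' = update S (.inr ⟨i, (tm i).k₁⟩) y := by
    funext k'
    by_cases hk : ∃ k, k' = .inr ⟨i, k⟩
    · obtain ⟨k, rfl⟩ := hk
      exact (h3 k).trans (hup _ _ k).symm
    · push Not at hk
      rw [update_of_ne (hk _)]
      exact h4 k' fun k => (hk k).symm
  exact hr

/-- Move a stack of bits to another stack, reversing it. -/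
def drain {K : Type} [DecidableEq K] {Γ : K → Type} {τ : Type} (a : K) (dec : Γ a → Bool) (k : K)
    (enc : Bool → Γ k) : Frag Γ (Option Bool × τ) :=
  fsm a dec () (fun _ b => ((), [⟨k, enc b⟩])) fun _ => []

theorem drain_runs {K : Type} [DecidableEq K] {Γ : K → Type} {τ : Type} {a : K} {dec : Γ a → Bool}
    {k : K} {enc : Bool → Γ k} (hak : k ≠ a) (v : τ) (S : ∀ k, List (Γ k)) (ha : S a = [])
    (hk : S k = []) (x : List (Γ a)) (y : List (Γ k))
    (hxy : y = ((x.map dec).map enc).reverse) :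
    (drain a dec k enc).Runs (none, v) (update S a x) (update S k y) (x.length + 1) := by
  have h := fsm_runs a dec () (fun _ b => ((), [(⟨k, enc b⟩ : Σ k, Γ k)])) (fun _ => [])
    (by simpa using hak) v (update S a x)
  have ht : ∀ l : List Bool, fsmTrace (fun (_ : Unit) b => ((), [(⟨k, enc b⟩ : Σ k, Γ k)]))
      (fun _ => []) () l = l.map fun b => ⟨k, enc b⟩ := by
    intro l
    induction l with
    | nil => rfl
    | cons b l ih => simp [fsmTrace, ih]
  have hu : update S a [] = S := by rw [← ha, update_eq_self]
  rw [update_self, ht, update_idem, hu, pushAll_single, hk, List.append_nil, ← hxy] at h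
  exact h

variable (e₀ : ∀ i, (tm i).Γ (tm i).k₀ ≃ Bool) (e₁ : ∀ i, (tm i).Γ (tm i).k₁ ≃ Bool)

/-- Replace the contents of the register `r` by the output of the subroutine `tm i` on it, using
`s` as an auxiliary register. -/
def call (i : ι) (r s : X) : Frag (BenchΓ X tm) (Benchσ tm) :=
  (drain (.inl r) id (.inl s) id).seq <|
    (drain (.inl s) id (.inr ⟨i, (tm i).k₀⟩) (e₀ i).symm).seq <|
      (runBox tm i).seq <|
        (drain (.inr ⟨i, (tm i).k₁⟩) (e₁ i) (.inl s) id).seq <|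
          drain (.inl s) id (.inl r) id

theorem call_runs {tm : ι → FinTM2} {e₀ : ∀ i, (tm i).Γ (tm i).k₀ ≃ Bool}
    {e₁ : ∀ i, (tm i).Γ (tm i).k₁ ≃ Bool} {i : ι} {r s : X} (hrs : r ≠ s) {c : X → Str}
    (hs : c s = []) {y : Str} {t : ℕ} (h : Outputs (tm i) (e₀ i) (e₁ i) (c r) y t) :
    (call tm e₀ e₁ i r s).RegRuns c (update c r y)
      (2 * (c r).length + 2 * y.length + t + 4) := by
  have hc : regs tm c = update (regs tm (update c r [])) (.inl r) (c r) := by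
    rw [← regs_update, update_idem, update_eq_self]
  have hy : regs tm (update c r y) = update (regs tm (update c r [])) (.inl r) y := by
    rw [← regs_update, update_idem]
  set S := regs tm (update c r []) with hS
  have hSr : S (.inl r) = [] := by simp [hS]
  have hSs : S (.inl s) = [] := by simp [hS, hrs.symm, hs]
  have hSi : ∀ i k, S (.inr ⟨i, k⟩) = [] := fun i k => by simp [hS]
  unfold RegRuns
  rw [hc, hy]
  have h1 := drain_runs (Γ := BenchΓ X tm) (a := .inl r) (k := .inl s) (dec := id) (enc := id)
    (by simpa using hrs.symm) (benchInit tm).2 S hSr hSs (c r) (c r).reverse (by simp)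
  have h2 := drain_runs (Γ := BenchΓ X tm) (a := .inl s) (k := .inr ⟨i, (tm i).k₀⟩) (dec := id)
    (enc := (e₀ i).symm) (by simp) (benchInit tm).2 S hSs (hSi _ _) (c r).reverse
    ((c r).map (e₀ i).symm) (by simp)
  have h3 := runBox_runs tm i h S (hSi i)
  have h4 := drain_runs (Γ := BenchΓ X tm) (a := .inr ⟨i, (tm i).k₁⟩) (k := .inl s) (dec := e₁ i)
    (enc := id) (by simp) (benchInit tm).2 S (hSi _ _) hSs (y.map (e₁ i).symm) y.reverse
    (by simp [Function.comp_def])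
  have h5 := drain_runs (Γ := BenchΓ X tm) (a := .inl s) (k := .inl r) (dec := id) (enc := id)
    (by simpa using hrs) (benchInit tm).2 S hSs hSr y.reverse y (by simp)
  refine (h1.seq (h2.seq (h3.seq (h4.seq h5)))).mono ?_
  simp only [List.length_map, List.length_reverse]
  omega

/-- The effect on registers of pushing a list of bits, the first one first. -/
def regPush (ps : List (X × Bool)) (c : X → Str) : X → Str :=
  fun x => (ps.filterMap fun p => if p.1 = x then some p.2 else none).reverse ++ c x

theorem pushAll_regs (ps : List (X × Bool)) (c : X → Str) :
    pushAll (ps.map fun p => (⟨.inl p.1, p.2⟩ : Σ k, BenchΓ X tm k)) (regs tm c) =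
      regs tm (regPush ps c) := by
  induction ps generalizing c with
  | nil => rfl
  | cons p ps ih =>
    rw [List.map_cons, pushAll]
    dsimp only
    rw [← regs_update, ih]
    congr 1
    funext x
    by_cases hx : p.1 = x
    · subst hx; simp [regPush]
    · simp [regPush, hx, update_of_ne (Ne.symm hx)]

/-- Push bits on registers. -/
def pushRegs (ps : List (X × Bool)) : Frag (BenchΓ X tm) (Benchσ tm) :=
  push (ps.map fun p => ⟨.inl p.1, p.2⟩)

theorem pushRegs_runs (ps : List (X × Bool)) (c : X → Str) :
    (pushRegs tm ps).RegRuns c (regPush ps c) 1 := by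
  unfold RegRuns
  rw [← pushAll_regs]
  exact push_runs _ _ _

/-- Empty a register with a finite-state transducer that pushes on other registers. -/
def transfer (a : X) {Q : Type} [Fintype Q] (q₀ : Q) (δ : Q → Bool → Q × List (X × Bool))
    (last : Q → List (X × Bool)) : Frag (BenchΓ X tm) (Benchσ tm) :=
  fsm (.inl a) id q₀ (fun q b => ((δ q b).1, (δ q b).2.map fun p => ⟨.inl p.1, p.2⟩))
    fun q => (last q).map fun p => ⟨.inl p.1, p.2⟩

theorem transfer_runs {a : X} {Q : Type} [Fintype Q] {q₀ : Q} {δ : Q → Bool → Q × List (X × Bool)}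
    {last : Q → List (X × Bool)} (hδ : ∀ q b, ∀ p ∈ (δ q b).2, p.1 ≠ a) {c c' : X → Str}
    (hc : regPush (fsmTrace δ last q₀ (c a)) (update c a []) = c') :
    (transfer tm a q₀ δ last).RegRuns c c' ((c a).length + 1) := by
  have h := fsm_runs (τ := ∀ i, (tm i).σ) (Γ := BenchΓ X tm) (.inl a) id q₀
    (fun q b => ((δ q b).1, (δ q b).2.map fun p => ⟨.inl p.1, p.2⟩))
    (fun q => (last q).map fun p => ⟨.inl p.1, p.2⟩)
    (by
      intro q b p hp
      obtain ⟨p', hp', rfl⟩ := List.mem_map.1 hp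
      simpa using hδ q b p' hp') (fun i => (tm i).initialState) (regs tm c)
  have ht : ∀ (l : List Bool) q, fsmTrace
      (fun q b => ((δ q b).1, (δ q b).2.map fun p => (⟨.inl p.1, p.2⟩ : Σ k, BenchΓ X tm k)))
      (fun q => (last q).map fun p => ⟨.inl p.1, p.2⟩) q l =
        (fsmTrace δ last q l).map fun p => ⟨.inl p.1, p.2⟩ := by
    intro l
    induction l with
    | nil => intro q; rfl
    | cons b l ih => intro q; simp [fsmTrace, ih]
  unfold RegRuns
  simp only [List.map_id, ht, ← regs_update, pushAll_regs, hc] at h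
  exact h

theorem RegRuns.seq {tm : ι → FinTM2} {F G : Frag (BenchΓ X tm) (Benchσ tm)} {c c' c'' : X → Str}
    {t u : ℕ} (hF : F.RegRuns c c' t) (hG : G.RegRuns c' c'' u) :
    (F.seq G).RegRuns c c'' (t + u) :=
  Runs.seq hF hG

theorem RegRuns.mono {tm : ι → FinTM2} {F : Frag (BenchΓ X tm) (Benchσ tm)} {c c' : X → Str}
    {t u : ℕ} (h : F.RegRuns c c' t) (htu : t ≤ u) : F.RegRuns c c' u :=
  Runs.mono h htu

/-- The machine that runs a program with registers and subroutines, with input and output in the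
registers `x₀` and `x₁`. -/
def toMachine [Fintype ι] [Fintype X] {tm : ι → FinTM2} (F : Frag (BenchΓ X tm) (Benchσ tm))
    (x₀ x₁ : X) : FinTM2 where
  K := BenchK X tm
  kFin := by have := fun i => (tm i).kFin; infer_instance
  k₀ := .inl x₀
  k₁ := .inl x₁
  Γ := BenchΓ X tm
  Λ := Option F.Lab
  main := some F.entry
  ΛFin := by have := F.fin; infer_instance
  σ := Benchσ tm
  initialState := benchInit tm
  σFin := by have := fun i => (tm i).σFin; infer_instance
  Γk₀Fin := inferInstanceAs (Fintype Bool)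
  m
    | none => .halt
    | some l => F.code some none l

theorem RegRuns.outputs [Fintype ι] [Fintype X] {tm : ι → FinTM2}
    {F : Frag (BenchΓ X tm) (Benchσ tm)} {x₀ x₁ : X} {x y : Str} {t : ℕ}
    (h : F.RegRuns (update (fun _ => []) x₀ x) (update (fun _ => []) x₁ y) t) :
    Outputs (F.toMachine x₀ x₁) (Equiv.refl Bool) (Equiv.refl Bool) x y (t + 1) := by
  have h1 := h (F.toMachine x₀ x₁).m some none fun l => rfl
  have h2 := h1.trans (Reach.single
    (b := ⟨none, benchInit tm, regs tm (update (fun _ => []) x₁ y)⟩) rfl)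
  unfold Outputs
  convert! h2 using 1
  · simp only [initList]
    congr 1
    funext k
    rcases k with z | p
    · by_cases hz : z = x₀
      · subst hz
        exact (dif_pos rfl).trans ((List.map_id x).trans (update_self z x fun _ => []).symm)
      · simp [toMachine, hz]
    · simp [toMachine]
  · simp only [haltList]
    change _ = TM2.Cfg.mk _ _ _
    congr 1
    funext k
    rcases k with z | p
    · by_cases hz : z = x₁
      · subst hz
        exact (dif_pos rfl).trans ((List.map_id y).trans (update_self z y fun _ => []).symm)
      · simp [toMachine, hz]
    · simp [toMachine]

end Frag

end Bench

/-! ### Closure properties of polynomial-time functions -/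

/-- An encoding of the elements of a type as strings. -/
class BitEnc (α : Type) where
  /-- the string that encodes an element -/
  enc : α → Str

open BitEnc

instance : BitEnc (List Bool) := ⟨id⟩

instance : BitEnc Bool := ⟨Computability.encodeBool⟩

/-- Natural numbers are encoded in unary. -/
instance : BitEnc ℕ := ⟨fun n => List.replicate n true⟩

instance {α β : Type} [BitEnc α] [BitEnc β] : BitEnc (α × β) := ⟨fun p => pair (enc p.1) (enc p.2)⟩

/-- The length of the string that encodes `a`. -/
def size {α : Type} [BitEnc α] (a : α) : ℕ := (enc a).length

/-- `f` is computable in polynomial time on encoded arguments. There is no requirement on the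
behaviour of the machine on strings that do not encode anything. -/
def PolyTime {α β : Type} [BitEnc α] [BitEnc β] (f : α → β) : Prop :=
  Nonempty (TM2ComputableInPolyTime (enc : α → Str) (enc : β → Str) f)

theorem polynomial_eval_mono (p : Polynomial ℕ) {m n : ℕ} (h : m ≤ n) : p.eval m ≤ p.eval n := by
  rw [Polynomial.eval_eq_sum_range, Polynomial.eval_eq_sum_range]
  exact Finset.sum_le_sum fun i _ => Nat.mul_le_mul_left _ (Nat.pow_le_pow_left h i)

namespace PolyTime

variable {α β γ : Type} [BitEnc α] [BitEnc β] [BitEnc γ]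

theorem exists_machine {f : α → β} (h : PolyTime f) :
    ∃ (M : TM2ComputableAux Bool Bool) (p q : Polynomial ℕ), ∀ a,
      Outputs M.tm M.inputAlphabet M.outputAlphabet (enc a) (enc (f a)) (p.eval (size a)) ∧
        size (f a) ≤ q.eval (size a) := by
  obtain ⟨M⟩ := h
  obtain ⟨C, hC⟩ := exists_length_output_le M.tm
  refine ⟨M.toTM2ComputableAux, M.time, Polynomial.X + Polynomial.C C * M.time, fun a => ?_⟩
  obtain ⟨⟨s, h1⟩, h2⟩ := M.outputsFun a
  have h3 : Outputs M.tm M.inputAlphabet M.outputAlphabet (enc a) (enc (f a))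
    (M.time.eval (size a)) := ⟨s, h2, h1⟩
  refine ⟨h3, ?_⟩
  simpa [size] using hC _ _ _ h3

theorem size_le {f : α → β} (h : PolyTime f) :
    ∃ q : Polynomial ℕ, ∀ a, size (f a) ≤ q.eval (size a) :=
  let ⟨_, _, q, hq⟩ := h.exists_machine; ⟨q, fun a => (hq a).2⟩

/-- A function is computable in polynomial time if a program with registers and subroutines computes
it in polynomial time, from one register to another. -/
theorem of_frag {f : α → β} {ι X : Type} [DecidableEq ι] [DecidableEq X] [Fintype ι] [Fintype X]
    {tm : ι → FinTM2} (F : Frag (BenchΓ X tm) (Benchσ tm)) (x₀ x₁ : X) (p : Polynomial ℕ)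
    (h : ∀ a, F.RegRuns (update (fun _ => []) x₀ (enc a)) (update (fun _ => []) x₁ (enc (f a)))
      (p.eval (size a))) : PolyTime f := by
  refine ⟨⟨⟨F.toMachine x₀ x₁, Equiv.refl Bool, Equiv.refl Bool⟩, p + 1, fun a => ?_⟩⟩
  have h1 := (h a).outputs
  exact ⟨⟨h1.choose, h1.choose_spec.2⟩, by simpa [size] using h1.choose_spec.1⟩

theorem update_zero_two (x : Str) : update (fun _ : Fin 2 => []) 0 x = ![x, []] := by
  funext i; fin_cases i <;> simp

theorem update_zero_three (x : Str) : update (fun _ : Fin 3 => []) 0 x = ![x, [], []] := by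
  funext i; fin_cases i <;> simp

theorem update_two_three (x : Str) : update (fun _ : Fin 3 => []) 2 x = ![[], [], x] := by
  funext i; fin_cases i <;> simp

theorem comp {f : α → β} {g : β → γ} (hg : PolyTime g) (hf : PolyTime f) :
    PolyTime fun a => g (f a) := by
  obtain ⟨M, p, q, hM⟩ := hf.exists_machine
  obtain ⟨N, p', q', hN⟩ := hg.exists_machine
  let B : Bool → TM2ComputableAux Bool Bool := fun b => cond b M N
  refine of_frag (ι := Bool) (X := Fin 2) (tm := fun i => (B i).tm)
    (.seq (.call _ (fun i => (B i).inputAlphabet) (fun i => (B i).outputAlphabet) true 0 1)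
      (.call _ (fun i => (B i).inputAlphabet) (fun i => (B i).outputAlphabet) false 0 1)) 0 0
    ((2 * .X + 2 * q + p + 4) + (2 * q + 2 * q'.comp q + p'.comp q + 4)) fun a => ?_
  have h1 := Frag.call_runs (tm := fun i => (B i).tm) (e₀ := fun i => (B i).inputAlphabet)
    (e₁ := fun i => (B i).outputAlphabet) (i := true) (r := (0 : Fin 2)) (s := 1) (by decide)
    (c := ![enc a, []]) rfl (hM a).1
  have h2 := Frag.call_runs (tm := fun i => (B i).tm) (e₀ := fun i => (B i).inputAlphabet)
    (e₁ := fun i => (B i).outputAlphabet) (i := false) (r := (0 : Fin 2)) (s := 1) (by decide)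
    (c := ![enc (f a), []]) rfl (hN (f a)).1
  rw [show update ![enc a, []] 0 (enc (f a)) = ![enc (f a), []] by
    funext i; fin_cases i <;> simp] at h1
  rw [show update ![enc (f a), []] 0 (enc (g (f a))) = ![enc (g (f a)), []] by
    funext i; fin_cases i <;> simp] at h2
  rw [update_zero_two, update_zero_two]
  refine (h1.seq h2).mono ?_
  have e1 := (hM a).2
  have e2 := (hN (f a)).2.trans (polynomial_eval_mono q' e1)
  have e3 := polynomial_eval_mono p' e1
  simp only [size] at *
  simp [Polynomial.eval_comp]
  omega

theorem fsmTrace_flatMap {A : Type} (g : Bool → List A) (l : List Bool) :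
    Frag.fsmTrace (fun (_ : Unit) b => ((), g b)) (fun _ => []) () l = l.flatMap g := by
  induction l with
  | nil => rfl
  | cons b l ih => simp [Frag.fsmTrace, ih]

/-- Copy each bit popped from a register to other registers. -/
abbrev copyBits {ι X : Type} [DecidableEq ι] [DecidableEq X] (tm : ι → FinTM2) (a : X)
    (g : List X) : Frag (BenchΓ X tm) (Benchσ tm) :=
  Frag.transfer tm a () (fun _ b => ((), g.map fun x => (x, b))) fun _ => []

theorem copyBits_runs {ι X : Type} [DecidableEq ι] [DecidableEq X] (tm : ι → FinTM2) {a : X}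
    {g : List X} (hg : a ∉ g) {c c' : X → Str}
    (hc : Frag.regPush ((c a).flatMap fun b => g.map fun x => (x, b)) (update c a []) = c') :
    (copyBits tm a g).RegRuns c c' ((c a).length + 1) :=
  Frag.transfer_runs tm (by simp; grind) (by rw [fsmTrace_flatMap, hc])

/-- As moving a stack reverses it, a copy of the register `0` in the register `2` is made with a
detour through the register `1`. -/
theorem duplicate_runs {ι : Type} [DecidableEq ι] (tm : ι → FinTM2) (x : Str) :
    ((copyBits tm (0 : Fin 3) [1]).seq (copyBits tm (1 : Fin 3) [0, 2])).RegRuns ![x, [], []]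
      ![x, [], x] (2 * x.length + 2) := by
  have h1 := copyBits_runs tm (a := (0 : Fin 3)) (g := [1]) (by decide) (c := ![x, [], []])
    (c' := ![[], x.reverse, []])
    (by funext i; fin_cases i <;> simp [Frag.regPush, List.filterMap_flatMap])
  have h2 := copyBits_runs tm (a := (1 : Fin 3)) (g := [0, 2]) (by decide)
    (c := ![[], x.reverse, []]) (c' := ![x, [], x])
    (by funext i; fin_cases i <;> simp [Frag.regPush, List.filterMap_flatMap])
  refine (h1.seq h2).mono ?_
  simp
  omega

theorem pair {f : α → β} {g : α → γ} (hf : PolyTime f) (hg : PolyTime g) :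
    PolyTime fun a => (f a, g a) := by
  obtain ⟨M, p, q, hM⟩ := hf.exists_machine
  obtain ⟨N, p', q', hN⟩ := hg.exists_machine
  let B : Bool → TM2ComputableAux Bool Bool := fun b => cond b M N
  refine of_frag (ι := Bool) (X := Fin 3) (tm := fun i => (B i).tm)
    (.seq (.seq (copyBits _ 0 [1]) (copyBits _ 1 [0, 2])) <|
      .seq (.call _ (fun i => (B i).inputAlphabet) (fun i => (B i).outputAlphabet) true 0 1) <|
      .seq (.call _ (fun i => (B i).inputAlphabet) (fun i => (B i).outputAlphabet) false 2 1) <|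
      .seq (.pushRegs _ [(2, true), (2, false)]) <|
      .seq (copyBits _ 0 [1]) (copyBits _ 1 [2, 2])) 0 2
    (2 * .X + 2 + ((2 * .X + 2 * q + p + 4) + (2 * .X + 2 * q' + p' + 4) + 1 + 2 * (q + 1)))
    fun a => ?_
  have h0 := duplicate_runs (fun i => (B i).tm) (enc a)
  have h1 := Frag.call_runs (tm := fun i => (B i).tm) (e₀ := fun i => (B i).inputAlphabet)
    (e₁ := fun i => (B i).outputAlphabet) (i := true) (r := (0 : Fin 3)) (s := 1) (by decide)
    (c := ![enc a, [], enc a]) rfl (hM a).1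
  have h2 := Frag.call_runs (tm := fun i => (B i).tm) (e₀ := fun i => (B i).inputAlphabet)
    (e₁ := fun i => (B i).outputAlphabet) (i := false) (r := (2 : Fin 3)) (s := 1) (by decide)
    (c := ![enc (f a), [], enc a]) rfl (hN a).1
  have h3 := Frag.pushRegs_runs (fun i => (B i).tm) [((2 : Fin 3), true), (2, false)]
    ![enc (f a), [], enc (g a)]
  have h4 := copyBits_runs (fun i => (B i).tm) (a := (0 : Fin 3)) (g := [1]) (by decide)
    (c := ![enc (f a), [], false :: true :: enc (g a)])
    (c' := ![[], (enc (f a)).reverse, false :: true :: enc (g a)])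
    (by funext i; fin_cases i <;> simp [Frag.regPush, List.filterMap_flatMap])
  have h5 := copyBits_runs (fun i => (B i).tm) (a := (1 : Fin 3)) (g := [2, 2]) (by decide)
    (c := ![[], (enc (f a)).reverse, false :: true :: enc (g a)])
    (c' := ![[], [], enc (f a, g a)])
    (by
      funext i
      fin_cases i <;>
        simp [Frag.regPush, List.filterMap_flatMap, List.reverse_flatMap, enc, PolyEq.pair,
          Function.comp_def])
  rw [show update ![enc a, [], enc a] 0 (enc (f a)) = ![enc (f a), [], enc a] by
    funext i; fin_cases i <;> simp] at h1
  rw [show update ![enc (f a), [], enc a] 2 (enc (g a)) = ![enc (f a), [], enc (g a)] by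
    funext i; fin_cases i <;> simp] at h2
  rw [show Frag.regPush [((2 : Fin 3), true), (2, false)] ![enc (f a), [], enc (g a)] =
    ![enc (f a), [], false :: true :: enc (g a)] by
      funext i; fin_cases i <;> simp [Frag.regPush]] at h3
  rw [update_zero_three, update_two_three]
  refine (h0.seq (h1.seq (h2.seq (h3.seq (h4.seq h5))))).mono ?_
  have e1 := (hM a).2
  have e2 := (hN a).2
  simp only [size] at *
  simp
  omega

theorem length_fsmTrace_le {Q A : Type} [Fintype Q] (δ : Q → Bool → Q × List A)
    (last : Q → List A) :
    ∃ C : ℕ, ∀ q l, (Frag.fsmTrace δ last q l).length ≤ C * (l.length + 1) := by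
  refine ⟨∑ q, ((last q).length + (δ q true).2.length + (δ q false).2.length), fun q l => ?_⟩
  have hC : ∀ q, (last q).length + (δ q true).2.length + (δ q false).2.length ≤ _ := fun q =>
    Finset.single_le_sum (f := fun q => (last q).length + (δ q true).2.length +
      (δ q false).2.length) (by simp) (Finset.mem_univ q)
  induction l generalizing q with
  | nil =>
    have := hC q
    simp only [Frag.fsmTrace, List.length_nil]
    omega
  | cons b l ih =>
    have h1 := hC q
    have h2 := ih (δ q b).1
    simp only [Frag.fsmTrace, List.length_append, List.length_cons]
    rw [Nat.mul_succ]
    cases b <;> omega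

/-- Functions computed by finite-state transducers are computable in polynomial time. -/
theorem of_transducer {f : α → β} {Q : Type} [Fintype Q] (q₀ : Q) (δ : Q → Bool → Q × Str)
    (last : Q → Str) (h : ∀ a, enc (f a) = Frag.fsmTrace δ last q₀ (enc a)) : PolyTime f := by
  obtain ⟨C, hC⟩ := length_fsmTrace_le δ last
  refine of_frag (ι := Empty) (X := Fin 2) (tm := Empty.elim)
    (.seq (Frag.transfer _ 0 q₀ (fun q b => ((δ q b).1, (δ q b).2.map fun x => (1, x)))
      fun q => (last q).map fun x => (1, x)) (copyBits _ 1 [0])) 0 0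
    (.X + 1 + (.C C * (.X + 1) + 1)) fun a => ?_
  have ht : ∀ (l : List Bool) q,
      Frag.fsmTrace (fun q b => ((δ q b).1, (δ q b).2.map fun x => ((1 : Fin 2), x)))
        (fun q => (last q).map fun x => (1, x)) q l =
      (Frag.fsmTrace δ last q l).map fun x => (1, x) := by
    intro l
    induction l with
    | nil => intro q; rfl
    | cons b l ih => intro q; simp [Frag.fsmTrace, ih]
  have h1 := Frag.transfer_runs (Empty.elim : Empty → FinTM2) (a := (0 : Fin 2)) (q₀ := q₀)
    (δ := fun q b => ((δ q b).1, (δ q b).2.map fun x => (1, x)))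
    (last := fun q => (last q).map fun x => (1, x)) (by simp) (c := ![enc a, []])
    (c' := ![[], (enc (f a)).reverse])
    (by
      rw [ht, h]
      funext i
      fin_cases i <;> simp [Frag.regPush])
  have h2 := copyBits_runs (Empty.elim : Empty → FinTM2) (a := (1 : Fin 2)) (g := [0]) (by decide)
    (c := ![[], (enc (f a)).reverse]) (c' := ![enc (f a), []])
    (by funext i; fin_cases i <;> simp [Frag.regPush, List.filterMap_flatMap])
  rw [update_zero_two, update_zero_two]
  refine (h1.seq h2).mono ?_
  have := hC q₀ (enc a)
  rw [← h] at this
  simp [size]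
  omega

/-- Bounded iteration: as many rounds as the input is long, provided that all the intermediate
results have polynomial length. -/
theorem iterate_size {f : α → α} (hf : PolyTime f) (q : Polynomial ℕ)
    (hq : ∀ a, ∀ i ≤ size a, size (f^[i] a) ≤ q.eval (size a)) :
    PolyTime fun a => f^[size a] a := by
  obtain ⟨M, p, _, hM⟩ := hf.exists_machine
  refine of_frag (ι := Unit) (X := Fin 3) (tm := fun _ => M.tm)
    (.seq (.seq (copyBits _ 0 [1]) (copyBits _ 1 [0, 2])) <|
      .loop (.inl 2) (.call _ (fun _ => M.inputAlphabet) (fun _ => M.outputAlphabet) () 0 1)) 0 0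
    (2 * .X + 2 + (.X * (1 + (2 * q + 2 * q + p.comp q + 4)) + 1)) fun a => ?_
  have h0 := duplicate_runs (fun _ : Unit => M.tm) (enc a)
  rw [update_zero_three, update_zero_three]
  set T := 1 + (2 * q.eval (size a) + 2 * q.eval (size a) + p.eval (q.eval (size a)) + 4) with hT
  -- the copy of the input in the register `2` counts the remaining rounds
  have key : ∀ (l : Str) (i : ℕ), i + l.length ≤ size a →
      (Frag.loop (.inl 2) (.call _ (fun _ => M.inputAlphabet) (fun _ => M.outputAlphabet)
        () 0 1)).RegRuns (tm := fun _ : Unit => M.tm) ![enc (f^[i] a), [], l]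
          ![enc (f^[i + l.length] a), [], []] (l.length * T + 1) := by
    intro l
    induction l with
    | nil =>
      intro i _
      exact (Frag.loop_runs_nil _ _ _ _ rfl).mono (by omega)
    | cons b l ih =>
      intro i hi
      rw [List.length_cons] at hi ⊢
      have h1 := Frag.call_runs (tm := fun _ : Unit => M.tm) (e₀ := fun _ => M.inputAlphabet)
        (e₁ := fun _ => M.outputAlphabet) (i := ()) (r := (0 : Fin 3)) (s := 1) (by decide)
        (c := ![enc (f^[i] a), [], l]) rfl (hM _).1
      rw [show update ![enc (f^[i] a), [], l] 0 (enc (f (f^[i] a))) =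
        ![enc (f^[i + 1] a), [], l] by
          funext i; fin_cases i <;> simp [← iterate_succ_apply']] at h1
      have h2 := ih (i + 1) (by omega)
      rw [show i + (l.length + 1) = i + 1 + l.length by omega]
      have h3 : update (regs (fun _ : Unit => M.tm) ![enc (f^[i] a), [], b :: l]) (.inl 2) l =
          regs (fun _ : Unit => M.tm) ![enc (f^[i] a), [], l] := by
        rw [← regs_update]
        congr 1
        funext i; fin_cases i <;> simp
      unfold Frag.RegRuns at h1
      rw [← h3] at h1
      refine (Frag.loop_runs_cons _ _ _ (S := regs _ ![enc (f^[i] a), [], b :: l]) (x := b)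
        (l := l) rfl h1 h2).mono ?_
      have e1 := hq a i (by omega)
      have e2 := hq a (i + 1) (by omega)
      rw [iterate_succ_apply'] at e2
      have e3 := polynomial_eval_mono p e1
      change (enc (f^[i] a)).length ≤ _ at e1
      change (enc (f (f^[i] a))).length ≤ _ at e2
      rw [add_one_mul, hT]
      simp
      omega
  have h1 := key (enc a) 0 (by simp [size])
  rw [Nat.zero_add] at h1
  refine (h0.seq h1).mono ?_
  simp [size, hT, Polynomial.eval_comp]

end PolyTime

/-! ### Polynomial-time toolkit -/

theorem pair_nil (y : Str) : pair [] y = false :: true :: y := rfl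

theorem pair_cons (b : Bool) (x y : Str) : pair (b :: x) y = b :: b :: pair x y := rfl

theorem length_pair (x y : Str) : (pair x y).length = 2 * x.length + 2 + y.length := by
  induction x with
  | nil => simp [pair_nil]; omega
  | cons b x ih => simp [pair_cons, ih]; omega

/-- The transitions of a transducer that reads `pair x y` and outputs `x` if `c` is true and `y`
otherwise. The states are `some none` between two doubled bits, `some (some b)` inside a doubled
bit `b`, and `none` after the separator. -/
def splitStep (c : Bool) : Option (Option Bool) → Bool → Option (Option Bool) × Str
  | none, b => (none, bif c then [] else [b])
  | some none, b => (some (some b), [])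
  | some (some b), b' =>
    if b = b' then (some none, bif c then [b] else []) else (none, [])

/-- The first component of the pair coded by a string. -/
def left (z : Str) : Str := Frag.fsmTrace (splitStep true) (fun _ => []) (some none) z

/-- The second component of the pair coded by a string. -/
def right (z : Str) : Str := Frag.fsmTrace (splitStep false) (fun _ => []) (some none) z

theorem split_after (c : Bool) (y : Str) :
    Frag.fsmTrace (splitStep c) (fun _ => []) none y = bif c then [] else y := by
  induction y with
  | nil => cases c <;> rfl
  | cons b y ih => cases c <;> simp_all [Frag.fsmTrace, splitStep]

theorem split_pair (c : Bool) (x y : Str) :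
    Frag.fsmTrace (splitStep c) (fun _ => []) (some none) (pair x y) = bif c then x else y := by
  induction x with
  | nil => cases c <;> simp [pair_nil, Frag.fsmTrace, splitStep, split_after]
  | cons b x ih => cases c <;> simp_all [pair_cons, Frag.fsmTrace, splitStep]

@[simp] theorem left_pair (x y : Str) : left (pair x y) = x := split_pair true x y

@[simp] theorem right_pair (x y : Str) : right (pair x y) = y := split_pair false x y

/-- The transitions of a transducer that reads the code of `(b, u, v)`, for a bit `b`, and outputs
`u` if `b` is true and `v` otherwise: it first reads `b` and skips three symbols. -/
def selectStep : Unit ⊕ (Bool × Fin 3) ⊕ (Bool × Option (Option Bool)) → Bool →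
    (Unit ⊕ (Bool × Fin 3) ⊕ (Bool × Option (Option Bool))) × Str
  | .inl _, b => (.inr (.inl (b, 0)), [])
  | .inr (.inl (c, 0)), _ => (.inr (.inl (c, 1)), [])
  | .inr (.inl (c, 1)), _ => (.inr (.inl (c, 2)), [])
  | .inr (.inl (c, 2)), _ => (.inr (.inr (c, some none)), [])
  | .inr (.inr (c, q)), b => (.inr (.inr (c, (splitStep c q b).1)), (splitStep c q b).2)

namespace PolyTime

variable {α β γ δ : Type} [BitEnc α] [BitEnc β] [BitEnc γ] [BitEnc δ]

theorem congr {f g : α → β} (hf : PolyTime f) (h : ∀ a, f a = g a) : PolyTime g :=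
  funext h ▸ hf

theorem fsmTrace_id (l : Str) :
    Frag.fsmTrace (fun (_ : Unit) b => ((), [b])) (fun _ => []) () l = l := by
  simp [fsmTrace_flatMap]

/-- A function that does nothing on encodings is computable in polynomial time. -/
theorem of_enc_eq {f : α → β} (h : ∀ a, enc (f a) = enc a) : PolyTime f :=
  of_transducer () (fun _ b => ((), [b])) (fun _ => []) fun a => by rw [h, fsmTrace_id]

theorem id' : PolyTime fun a : α => a := of_enc_eq fun _ => rfl

theorem const (b : β) : PolyTime fun _ : α => b :=
  of_transducer () (fun _ _ => ((), [])) (fun _ => enc b) fun a => by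
    induction enc a with
    | nil => rfl
    | cons x l ih => exact ih

theorem left : PolyTime left := of_transducer _ _ _ fun _ => rfl

theorem right : PolyTime right := of_transducer _ _ _ fun _ => rfl

theorem fst' : PolyTime fun p : α × β => p.1 :=
  of_transducer _ _ _ fun p => (left_pair (enc p.1) (enc p.2)).symm

theorem snd' : PolyTime fun p : α × β => p.2 :=
  of_transducer _ _ _ fun p => (right_pair (enc p.1) (enc p.2)).symm

theorem fst {f : α → β × γ} (hf : PolyTime f) : PolyTime fun a => (f a).1 := fst'.comp hf

theorem snd {f : α → β × γ} (hf : PolyTime f) : PolyTime fun a => (f a).2 := snd'.comp hf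

theorem pair_str {f g : α → Str} (hf : PolyTime f) (hg : PolyTime g) :
    PolyTime fun a => PolyEq.pair (f a) (g a) :=
  comp (g := fun p : Str × Str => PolyEq.pair p.1 p.2) (of_enc_eq fun _ => rfl) (hf.pair hg)

theorem fsmTrace_select (c : Bool) (q : Option (Option Bool)) (l : Str) :
    Frag.fsmTrace selectStep (fun _ => []) (.inr (.inr (c, q))) l =
      Frag.fsmTrace (splitStep c) (fun _ => []) q l := by
  induction l generalizing q with
  | nil => rfl
  | cons b l ih => simp [Frag.fsmTrace, selectStep, ih]

/-- Both branches are evaluated, and a transducer selects the result. -/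
theorem cond {c : α → Bool} {f g : α → β} (hc : PolyTime c) (hf : PolyTime f) (hg : PolyTime g) :
    PolyTime fun a => bif c a then f a else g a := by
  refine comp (g := fun p : Bool × β × β => bif p.1 then p.2.1 else p.2.2) ?_
    (hc.pair (hf.pair hg))
  refine of_transducer (.inl ()) selectStep (fun _ => []) fun ⟨b, u, v⟩ => ?_
  change _ = Frag.fsmTrace _ _ _ (b :: b :: false :: true :: PolyEq.pair (enc u) (enc v))
  simp only [Frag.fsmTrace, selectStep, List.nil_append, fsmTrace_select, split_pair]
  cases b <;> rfl

theorem and {f g : α → Bool} (hf : PolyTime f) (hg : PolyTime g) :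
    PolyTime fun a => f a && g a :=
  (hf.cond hg (const false)).congr fun a => by cases f a <;> rfl

theorem or {f g : α → Bool} (hf : PolyTime f) (hg : PolyTime g) :
    PolyTime fun a => f a || g a :=
  (hf.cond (const true) hg).congr fun a => by cases f a <;> rfl

theorem not {f : α → Bool} (hf : PolyTime f) : PolyTime fun a => !f a :=
  (hf.cond (const false) (const true)).congr fun a => by cases f a <;> rfl

theorem xor {f g : α → Bool} (hf : PolyTime f) (hg : PolyTime g) :
    PolyTime fun a => f a ^^ g a :=
  (hf.cond hg.not hg).congr fun a => by cases f a <;> cases g a <;> rfl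

theorem fsmTrace_map (g : Bool → Bool) (l : Str) :
    Frag.fsmTrace (fun (_ : Unit) b => ((), [g b])) (fun _ => []) () l = l.map g := by
  rw [fsmTrace_flatMap, List.map_eq_flatMap]

/-- The transducer that remembers the first symbol and outputs it at the end. -/
theorem fsmTrace_some (l : Str) :
    Frag.fsmTrace (fun (q : Option Bool) b => (some (q.getD b), [])) (fun q => [q.getD false])
      none l = [l.headD false] := by
  have h : ∀ b (l : Str), Frag.fsmTrace (fun (q : Option Bool) b => (some (q.getD b), ([] : Str)))
      (fun q => [q.getD false]) (some b) l = [b] := by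
    intro b l
    induction l with
    | nil => rfl
    | cons x l ih => exact ih
  cases l with
  | nil => rfl
  | cons x l => exact h x l

theorem length {f : α → Str} (hf : PolyTime f) : PolyTime fun a => (f a).length :=
  comp (g := List.length) (of_transducer _ _ _ fun l => by
    rw [show enc l = l from rfl, fsmTrace_map fun _ => true, List.map_const']; rfl) hf

theorem headD {f : α → Str} (hf : PolyTime f) : PolyTime fun a => (f a).headD false :=
  comp (g := fun l : Str => l.headD false) (of_transducer _ _ _ fun l => (fsmTrace_some l).symm) hf

theorem fsmTrace_tail (l : Str) :
    Frag.fsmTrace (fun (q : Bool) b => (true, bif q then [b] else [])) (fun _ => []) false l =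
      l.tail := by
  have h : ∀ l : Str, Frag.fsmTrace (fun (q : Bool) b => (true, bif q then [b] else []))
      (fun _ => []) true l = l := by
    intro l
    induction l with
    | nil => rfl
    | cons x l ih => simp [Frag.fsmTrace, ih]
  cases l with
  | nil => rfl
  | cons x l => exact h l

theorem tail {f : α → Str} (hf : PolyTime f) : PolyTime fun a => (f a).tail :=
  comp (g := List.tail) (of_transducer _ _ _ fun l => (fsmTrace_tail l).symm) hf

theorem isEmpty {f : α → Str} (hf : PolyTime f) : PolyTime fun a => (f a).isEmpty :=
  comp (g := fun l : Str => l.isEmpty) (of_transducer (Q := Bool) true (fun _ _ => (false, []))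
    (fun q => [q]) fun l => by
      have h : ∀ l : Str, Frag.fsmTrace (fun (_ : Bool) (_ : Bool) => (false, ([] : Str)))
          (fun q => [q]) false l = [false] := by
        intro l
        induction l with
        | nil => rfl
        | cons x l ih => exact ih
      cases l with
      | nil => rfl
      | cons x l => exact (h l).symm) hf

/-- Test if a string contains the bit `1`. -/
theorem contains_true {f : α → Str} (hf : PolyTime f) :
    PolyTime fun a => (f a).contains true :=
  comp (g := fun l : Str => l.contains true) (of_transducer (Q := Bool) false
    (fun q b => (q || b, [])) (fun q => [q]) fun l => by
      have h : ∀ (l : Str) q, Frag.fsmTrace (fun (q : Bool) (b : Bool) => (q || b, ([] : Str)))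
          (fun q => [q]) q l = [q || l.contains true] := by
        intro l
        induction l with
        | nil => intro q; simp [Frag.fsmTrace]
        | cons x l ih => intro q; cases x <;> simp [Frag.fsmTrace, ih]
      exact ((h l false).trans (by simp; rfl)).symm) hf

theorem cons {f : α → Bool} {g : α → Str} (hf : PolyTime f) (hg : PolyTime g) :
    PolyTime fun a => f a :: g a := by
  have h : PolyTime fun a => PolyEq.pair [f a] (g a) :=
    comp (g := fun p : Bool × Str => PolyEq.pair [p.1] p.2) (of_enc_eq fun _ => rfl) (hf.pair hg)
  -- `pair [b] l` is `b :: b :: 0 :: 1 :: l`: delete the second, the third and the fourth symbol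
  refine (comp (g := fun l : Str => l.headD false :: l.tail.tail.tail.tail) ?_ h).congr
    fun a => rfl
  refine of_transducer (Q := Fin 5) 0
    (fun q b => (if q = 4 then 4 else q + 1, if q = 0 ∨ q = 4 then [b] else []))
    (fun q => if q = 0 then [false] else []) fun l => ?_
  have h4 : ∀ l : Str, Frag.fsmTrace
      (fun (q : Fin 5) b => (if q = 4 then 4 else q + 1, if q = 0 ∨ q = 4 then [b] else []))
      (fun q => if q = 0 then [false] else []) 4 l = l := by
    intro l
    induction l with
    | nil => rfl
    | cons x l ih => simp [Frag.fsmTrace, ih]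
  rcases l with - | ⟨a, - | ⟨b, - | ⟨c, - | ⟨d, l⟩⟩⟩⟩
  · rfl
  · rfl
  · rfl
  · rfl
  · exact congrArg (a :: ·) (h4 l).symm

theorem succ {f : α → ℕ} (hf : PolyTime f) : PolyTime fun a => f a + 1 :=
  comp (g := List.length) (length id')
    (comp (g := fun l : Str => true :: l) ((const true).cons id')
      (comp (g := fun n : ℕ => List.replicate n true) (of_enc_eq fun _ => rfl) hf)) |>.congr
        fun a => by simp

theorem pred {f : α → ℕ} (hf : PolyTime f) : PolyTime fun a => f a - 1 :=
  comp (g := List.length) (length id')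
    (comp (g := fun l : Str => l.tail) (tail id')
      (comp (g := fun n : ℕ => List.replicate n true) (of_enc_eq fun _ => rfl) hf)) |>.congr
        fun a => by simp

theorem eq_zero {f : α → ℕ} (hf : PolyTime f) : PolyTime fun a => decide (f a = 0) :=
  comp (g := fun l : Str => l.isEmpty) (isEmpty id')
    (comp (g := fun n : ℕ => List.replicate n true) (of_enc_eq fun _ => rfl) hf) |>.congr
        fun a => by cases f a <;> simp [List.replicate_succ]

@[simp] theorem size_nat (n : ℕ) : size n = n := by simp [size, enc]

@[simp] theorem size_str (x : Str) : size x = x.length := rfl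

@[simp] theorem size_bool (b : Bool) : size b = 1 := rfl

@[simp] theorem size_prod (p : α × β) : size p = 2 * size p.1 + 2 + size p.2 :=
  length_pair _ _

/-- Bounded iteration with a given number of rounds. -/
theorem iterate_nat {f : α → α} (hf : PolyTime f) (q : Polynomial ℕ)
    (hq : ∀ n a, ∀ i ≤ n, size (f^[i] a) ≤ q.eval (n + size a)) :
    PolyTime fun p : ℕ × α => f^[p.1] p.2 := by
  -- the rounds in excess of `n` leave the state unchanged
  set F : ℕ × α → ℕ × α := fun p => (p.1 - 1, bif decide (p.1 = 0) then p.2 else f p.2) with hF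
  have h1 : PolyTime F :=
    (pred fst').pair ((eq_zero fst').cond snd' (hf.comp snd'))
  have h2 : ∀ (i n : ℕ) (a : α), F^[i] (n, a) = (n - i, f^[min i n] a) := by
    intro i n a
    induction i with
    | zero => simp
    | succ i ih =>
      rw [iterate_succ_apply', ih, hF]
      by_cases h : n ≤ i
      · simp [h, Nat.sub_eq_zero_of_le h, Nat.sub_eq_zero_of_le (h.trans (Nat.le_succ i)),
          min_eq_right (h.trans (Nat.le_succ i))]
      · push Not at h
        rw [min_eq_left h.le, min_eq_left (Nat.succ_le_of_lt h), iterate_succ_apply']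
        have : n - i ≠ 0 := by omega
        simp [this]
        omega
  refine (snd (h1.iterate_size (2 * .X + 2 + q) ?_)).congr ?_
  · rintro ⟨n, a⟩ i -
    have := hq n a (min i n) (by omega)
    have h3 := polynomial_eval_mono q (show n + size a ≤ 2 * n + 2 + size a by omega)
    rw [h2]
    simp
    omega
  · rintro ⟨n, a⟩
    rw [h2, min_eq_right]
    simp
    omega

/-- Iteration of a function with a parameter that increases sizes, in each round, by at most a
polynomial in the size of the parameter. -/
theorem iterate {h : γ × β → β} (hh : PolyTime h) (K : Polynomial ℕ)
    (hK : ∀ c b, size (h (c, b)) ≤ size b + K.eval (size c)) {n : α → ℕ} {c : α → γ} {s : α → β}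
    (hn : PolyTime n) (hc : PolyTime c) (hs : PolyTime s) :
    PolyTime fun a => (fun b => h (c a, b))^[n a] (s a) := by
  set F : γ × β → γ × β := fun p => (p.1, h p) with hF
  have h1 : PolyTime F := fst'.pair hh
  have h2 : ∀ (i : ℕ) c b, F^[i] (c, b) = (c, (fun b => h (c, b))^[i] b) := by
    intro i c b
    induction i with
    | zero => rfl
    | succ i ih => rw [iterate_succ_apply', iterate_succ_apply', ih]
  have h3 : ∀ (i : ℕ) c b, size ((fun b => h (c, b))^[i] b) ≤ size b + i * K.eval (size c) := by
    intro i c b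
    induction i with
    | zero => simp
    | succ i ih =>
      rw [iterate_succ_apply', Nat.succ_mul]
      have := hK c ((fun b => h (c, b))^[i] b)
      omega
  refine (snd (comp (h1.iterate_nat (2 * .X + 2 + .X * K) ?_) (hn.pair (hc.pair hs)))).congr
    fun a => by simp [h2]
  rintro n ⟨c, b⟩ i hi
  rw [h2]
  have e1 := h3 i c b
  have e2 : i * K.eval (size c) ≤ (n + (2 * size c + 2 + size b)) *
      K.eval (n + (2 * size c + 2 + size b)) :=
    Nat.mul_le_mul (by omega) (polynomial_eval_mono K (by omega))
  simp
  omega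

theorem add {f g : α → ℕ} (hf : PolyTime f) (hg : PolyTime g) : PolyTime fun a => f a + g a :=
  (iterate (h := fun p : ℕ × ℕ => p.2 + 1) (succ snd') 1 (by simp) hf hf hg).congr fun a => by
    simp [add_comm]

theorem mul {f g : α → ℕ} (hf : PolyTime f) (hg : PolyTime g) : PolyTime fun a => f a * g a :=
  (iterate (h := fun p : ℕ × ℕ => p.2 + p.1) (snd'.add fst') .X (by simp) hf hg
    (const 0)).congr fun a => by
      generalize f a = n
      induction n with
      | zero => simp
      | succ n ih => rw [iterate_succ_apply', ih, Nat.succ_mul]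

theorem sub {f g : α → ℕ} (hf : PolyTime f) (hg : PolyTime g) : PolyTime fun a => f a - g a :=
  (iterate (h := fun p : ℕ × ℕ => p.2 - 1) (pred snd') 0 (by simp) hg hf hf).congr fun a => by
    generalize g a = n
    induction n with
    | zero => simp
    | succ n ih => rw [iterate_succ_apply', ih]; rfl

theorem le {f g : α → ℕ} (hf : PolyTime f) (hg : PolyTime g) :
    PolyTime fun a => decide (f a ≤ g a) :=
  (eq_zero (hf.sub hg)).congr fun a => by simp [Nat.sub_eq_zero_iff_le]

theorem lt {f g : α → ℕ} (hf : PolyTime f) (hg : PolyTime g) :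
    PolyTime fun a => decide (f a < g a) :=
  (le (succ hf) hg).congr fun _ => rfl

theorem eq_nat {f g : α → ℕ} (hf : PolyTime f) (hg : PolyTime g) :
    PolyTime fun a => decide (f a = g a) :=
  ((le hf hg).and (le hg hf)).congr fun a => by
    rw [← Bool.decide_and]; exact decide_eq_decide.2 (by omega)

theorem eval (p : Polynomial ℕ) {f : α → ℕ} (hf : PolyTime f) : PolyTime fun a => p.eval (f a) := by
  induction p using Polynomial.induction_on with
  | C c => exact (const c).congr fun a => by simp
  | add p q hp hq => exact (hp.add hq).congr fun a => by simp
  | monomial n c ih =>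
    exact (ih.mul hf).congr fun a => by simp [pow_succ, mul_assoc]

theorem drop {n : α → ℕ} {f : α → Str} (hn : PolyTime n) (hf : PolyTime f) :
    PolyTime fun a => (f a).drop (n a) :=
  (iterate (h := fun p : ℕ × Str => p.2.tail) (tail snd') 0 (by simp) hn hn hf).congr fun a => by
    generalize n a = n
    induction n with
    | zero => simp
    | succ n ih => rw [iterate_succ_apply', ih]; simp

/-- Moving the first `n` symbols of a string to another string reverses them. -/
theorem reverse_take {n : α → ℕ} {f : α → Str} (hn : PolyTime n) (hf : PolyTime f) :
    PolyTime fun a => ((f a).take (n a)).reverse := by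
  refine (snd (iterate (h := fun p : ℕ × Str × Str => bif p.2.1.isEmpty then p.2 else
    (p.2.1.tail, p.2.1.headD false :: p.2.2))
    ((isEmpty (fst snd')).cond snd' ((tail (fst snd')).pair ((headD (fst snd')).cons (snd snd'))))
    1 ?_ hn hn (hf.pair (const [])))).congr fun a => ?_
  · rintro - ⟨- | ⟨b, x⟩, y⟩ <;> simp
    omega
  · suffices h : ∀ (n : ℕ) (x y : Str), ((fun p : Str × Str => bif p.1.isEmpty then p else
        (p.1.tail, p.1.headD false :: p.2))^[n] (x, y)).2 = (x.take n).reverse ++ y by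
      simpa using h (n a) (f a) []
    intro n
    induction n with
    | zero => simp
    | succ n ih =>
      rintro (- | ⟨b, x⟩) y
      · simpa using ih [] y
      · simpa using ih x (b :: y)

theorem reverse {f : α → Str} (hf : PolyTime f) : PolyTime fun a => (f a).reverse :=
  (reverse_take hf.length hf).congr fun a => by simp

theorem take {n : α → ℕ} {f : α → Str} (hn : PolyTime n) (hf : PolyTime f) :
    PolyTime fun a => (f a).take (n a) :=
  (reverse (reverse_take hn hf)).congr fun a => by simp

theorem zipWith_xor {f g : α → Str} (hf : PolyTime f) (hg : PolyTime g) :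
    PolyTime fun a => List.zipWith Bool.xor (f a) (g a) := by
  refine (reverse (snd (snd (iterate (h := fun p : ℕ × Str × Str × Str =>
    bif p.2.1.isEmpty || p.2.2.1.isEmpty then p.2 else
      (p.2.1.tail, p.2.2.1.tail, (p.2.1.headD false ^^ p.2.2.1.headD false) :: p.2.2.2))
    (((isEmpty (fst snd')).or (isEmpty (fst (snd snd')))).cond snd'
      ((tail (fst snd')).pair ((tail (fst (snd snd'))).pair
        (((headD (fst snd')).xor (headD (fst (snd snd')))).cons (snd (snd snd'))))))
    1 ?_ hf.length hf.length (hf.pair (hg.pair (const []))))))).congr fun a => ?_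
  · rintro - ⟨- | ⟨b, x⟩, - | ⟨c, y⟩, z⟩ <;> simp
    omega
  · suffices h : ∀ (x y z : Str), ((fun p : Str × Str × Str =>
        bif p.1.isEmpty || p.2.1.isEmpty then p else
          (p.1.tail, p.2.1.tail, (p.1.headD false ^^ p.2.1.headD false) :: p.2.2))^[x.length]
            (x, y, z)).2.2 = (List.zipWith Bool.xor x y).reverse ++ z by
      simpa using congrArg List.reverse (h (f a) (g a) [])
    intro x
    induction x with
    | nil => simp
    | cons b x ih =>
      rintro (- | ⟨c, y⟩) z
      · rw [List.length_cons, iterate_fixed (by simp)]; simp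
      · rw [List.length_cons, iterate_succ_apply]
        simpa using ih y ((b ^^ c) :: z)

theorem eq_str {f g : α → Str} (hf : PolyTime f) (hg : PolyTime g) :
    PolyTime fun a => decide (f a = g a) :=
  ((eq_nat hf.length hg.length).and (not (contains_true (zipWith_xor hf hg)))).congr fun a => by
    rw [Bool.eq_iff_iff]
    simp only [Bool.and_eq_true, decide_eq_true_eq, Bool.not_eq_true', List.contains_eq_mem,
      decide_eq_false_iff_not]
    generalize f a = x
    generalize g a = y
    induction x generalizing y with
    | nil => cases y <;> simp
    | cons b x ih =>
      cases y with
      | nil => simp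
      | cons c y =>
        have := ih y
        cases b <;> cases c <;> simp_all

end PolyTime

/-- The number of blocks with property `φ` among the first `k` blocks of length `m` of a string. -/
def blockCount (φ : Str → Bool) (m : ℕ) : ℕ → Str → ℕ
  | 0, _ => 0
  | k + 1, s => (φ (s.take m)).toNat + blockCount φ m k (s.drop m)

theorem PolyTime.blockCount {α γ : Type} [BitEnc α] [BitEnc γ] {φ : γ × Str → Bool}
    (hφ : PolyTime φ) {c : α → γ} {m k : α → ℕ} {s : α → Str} (hc : PolyTime c)
    (hm : PolyTime m) (hk : PolyTime k) (hs : PolyTime s) :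
    PolyTime fun a => blockCount (fun b => φ (c a, b)) (m a) (k a) (s a) := by
  refine (snd (iterate (h := fun p : (γ × ℕ) × Str × ℕ => (p.2.1.drop p.1.2,
      bif φ (p.1.1, p.2.1.take p.1.2) then p.2.2 + 1 else p.2.2))
    ((drop (snd fst') (fst snd')).pair
      ((hφ.comp ((fst fst').pair (take (snd fst') (fst snd')))).cond (succ (snd snd')) (snd snd')))
    1 ?_ hk (hc.pair hm) (hs.pair (const 0)))).congr fun a => ?_
  · rintro ⟨c, m⟩ ⟨s, n⟩
    cases φ (c, s.take m) <;> simp <;> omega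
  · suffices h : ∀ (k : ℕ) (s : Str) (n : ℕ), ((fun p : Str × ℕ => (p.1.drop (m a),
        bif φ (c a, p.1.take (m a)) then p.2 + 1 else p.2))^[k] (s, n)).2 =
          n + PolyEq.blockCount (fun b => φ (c a, b)) (m a) k s by
      simpa using h (k a) (s a) 0
    intro k
    induction k with
    | zero => simp [PolyEq.blockCount]
    | succ k ih =>
      intro s n
      rw [iterate_succ_apply, ih, PolyEq.blockCount]
      cases φ (c a, s.take (m a))
      · simp
      · simp; omega

/-- Remove leading zeros and the first one. -/
def unpad (l : Str) : Str :=
  Frag.fsmTrace (fun (q : Bool) b => (q || b, bif q then [b] else [])) (fun _ => []) false l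

theorem PolyTime.unpad {α : Type} [BitEnc α] {f : α → Str} (hf : PolyTime f) :
    PolyTime fun a => unpad (f a) :=
  comp (g := PolyEq.unpad) (of_transducer _ _ _ fun _ => rfl) hf

theorem unpad_false (l : Str) : unpad (false :: l) = unpad l := rfl

theorem unpad_true (l : Str) : unpad (true :: l) = l := by
  change Frag.fsmTrace _ _ true l = l
  induction l with
  | nil => rfl
  | cons b l ih => simp [Frag.fsmTrace, ih]

theorem unpad_replicate (n : ℕ) (w : Str) : unpad (List.replicate n false ++ true :: w) = w := by
  induction n with
  | zero => exact unpad_true w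
  | succ n ih => rw [List.replicate_succ, List.cons_append, unpad_false, ih]

/-! ### Counting strings -/

/-- The set of strings of length `n`. -/
def strs (n : ℕ) : Finset Str :=
  (Finset.univ : Finset (List.Vector Bool n)).map
    ⟨List.Vector.toList, List.Vector.toList_injective⟩

@[simp] theorem mem_strs {n : ℕ} {s : Str} : s ∈ strs n ↔ s.length = n := by
  constructor
  · intro h
    obtain ⟨v, -, rfl⟩ := Finset.mem_map.1 h
    exact v.2
  · intro h
    exact Finset.mem_map.2 ⟨⟨s, h⟩, Finset.mem_univ _, rfl⟩

@[simp] theorem card_strs (n : ℕ) : (strs n).card = 2 ^ n := by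
  simp [strs]

theorem sum_strs_add {M : Type*} [AddCommMonoid M] (a b : ℕ) (F : Str → M) :
    ∑ s ∈ strs (a + b), F s = ∑ u ∈ strs a, ∑ v ∈ strs b, F (u ++ v) := by
  rw [← Finset.sum_product']
  refine (Finset.sum_nbij' (fun p => p.1 ++ p.2) (fun s => (s.take a, s.drop a))
    ?_ ?_ ?_ ?_ ?_).symm
  · rintro ⟨u, v⟩ h; simp_all
  · intro s h; simp_all
  · rintro ⟨u, v⟩ h
    simp only [Finset.mem_product, mem_strs] at h
    simp [← h.1]
  · simp
  · simp

/-- The number of strings of length `n` with a given property. -/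
def cnt (n : ℕ) (P : Str → Prop) [DecidablePred P] : ℕ := ((strs n).filter P).card

section cnt

variable {n : ℕ} {P Q : Str → Prop} [DecidablePred P] [DecidablePred Q]

theorem cnt_eq_sum : cnt n P = ∑ s ∈ strs n, if P s then 1 else 0 := Finset.card_filter _ _

theorem cnt_mono (h : ∀ s, s.length = n → P s → Q s) : cnt n P ≤ cnt n Q :=
  Finset.card_le_card fun s hs => by
    simp only [Finset.mem_filter, mem_strs] at hs ⊢
    exact ⟨hs.1, h s hs.1 hs.2⟩

theorem cnt_congr (h : ∀ s, s.length = n → (P s ↔ Q s)) : cnt n P = cnt n Q :=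
  (cnt_mono fun s hs => (h s hs).1).antisymm (cnt_mono fun s hs => (h s hs).2)

theorem cnt_or_le : (cnt n fun s => P s ∨ Q s) ≤ cnt n P + cnt n Q := by
  unfold cnt
  rw [Finset.filter_or]
  exact Finset.card_union_le _ _

theorem cnt_add_cnt_not : cnt n P + (cnt n fun s => ¬ P s) = 2 ^ n := by
  unfold cnt
  rw [Finset.card_filter_add_card_filter_not, card_strs]

theorem exists_of_cnt_lt (h : cnt n P < 2 ^ n) : ∃ s, s.length = n ∧ ¬ P s := by
  by_contra! hc
  rw [← cnt_add_cnt_not (P := P)] at h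
  have : (cnt n fun s => ¬ P s) = 0 := by
    rw [cnt, Finset.card_eq_zero, Finset.filter_eq_empty_iff]
    exact fun s hs hn => hn (hc s (mem_strs.1 hs))
  omega

theorem ncard_eq_cnt : {r : Str | r.length = n ∧ P r}.ncard = cnt n P := by
  rw [cnt, ← Set.ncard_coe_finset]
  congr 1
  ext r
  simp

/-- Count over prefixes. -/
theorem cnt_take (a b : ℕ) : (cnt (a + b) fun s => P (s.take a)) = cnt a P * 2 ^ b := by
  rw [cnt_eq_sum, cnt_eq_sum, sum_strs_add, Finset.sum_mul]
  refine Finset.sum_congr rfl fun u hu => ?_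
  have : ∀ v, (u ++ v).take a = u := fun v => by simp [← mem_strs.1 hu]
  simp [this]

/-- Count fibrewise, with a bound for each fibre. -/
theorem cnt_append_le {R : Str → Str → Prop} [∀ r, DecidablePred (R r)] (a b c : ℕ)
    (h : ∀ u, u.length = a → cnt b (R u) ≤ c) :
    (cnt (a + b) fun s => R (s.take a) (s.drop a)) ≤ 2 ^ a * c := by
  rw [cnt_eq_sum, sum_strs_add, ← card_strs a, ← smul_eq_mul]
  refine Finset.sum_le_card_nsmul _ _ _ fun u hu => ?_
  rw [mem_strs] at hu
  refine le_trans (le_of_eq ?_) (h u hu)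
  rw [cnt_eq_sum]
  refine Finset.sum_congr rfl fun v _ => ?_
  simp [← hu]

theorem cnt_exists_le {ι : Type*} (I : Finset ι) {R : ι → Str → Prop} [∀ i, DecidablePred (R i)]
    [DecidablePred fun s => ∃ i ∈ I, R i s] {c : ℕ} (h : ∀ i ∈ I, cnt n (R i) ≤ c) :
    (cnt n fun s => ∃ i ∈ I, R i s) ≤ I.card * c := by
  classical
  have : (strs n).filter (fun s => ∃ i ∈ I, R i s) = I.biUnion fun i => (strs n).filter (R i) := by
    ext s; simp; tauto
  rw [cnt, this]
  exact Finset.card_biUnion_le_card_mul _ _ _ h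

end cnt

/-- Bitwise exclusive or. -/
abbrev bxor (x y : Str) : Str := List.zipWith Bool.xor x y

theorem bxor_comm (x y : Str) : bxor x y = bxor y x :=
  List.zipWith_comm_of_comm Bool.xor_comm

theorem bxor_bxor {x y : Str} (h : x.length = y.length) : bxor x (bxor x y) = y := by
  induction x generalizing y with
  | nil => cases y <;> simp_all
  | cons a x ih => cases y <;> simp_all

theorem cnt_bxor {n : ℕ} {P : Str → Prop} [DecidablePred P] {r : Str} (hr : r.length = n) :
    (cnt n fun s => P (bxor r s)) = cnt n P := by
  rw [cnt_eq_sum, cnt_eq_sum]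
  refine Finset.sum_nbij' (bxor r) (bxor r) ?_ ?_ ?_ ?_ ?_ <;>
    simp +contextual [hr, bxor_bxor]

/-! ### Repeated trials -/

theorem blockCount_not (φ : Str → Bool) (m k : ℕ) (s : Str) :
    blockCount (fun b => !φ b) m k s + blockCount φ m k s = k := by
  induction k generalizing s with
  | zero => rfl
  | succ k ih =>
    have := ih (s.drop m)
    simp only [blockCount]
    cases φ (s.take m) <;> simp <;> omega

theorem blockCount_append (φ : Str → Bool) {m : ℕ} {u : Str} (hu : u.length = m) (k : ℕ) (v : Str) :
    blockCount φ m (k + 1) (u ++ v) = (φ u).toNat + blockCount φ m k v := by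
  simp [blockCount, ← hu]

/-- The exponential moment of the number of blocks with property `φ` is a product. -/
theorem sum_two_pow_blockCount (φ : Str → Bool) (m k : ℕ) :
    ∑ s ∈ strs (k * m), 2 ^ blockCount φ m k s = (2 ^ m + cnt m fun b => φ b = true) ^ k := by
  have h1 : ∑ u ∈ strs m, 2 ^ (φ u).toNat = 2 ^ m + cnt m fun b => φ b = true := by
    rw [cnt_eq_sum, ← card_strs, Finset.card_eq_sum_ones, ← Finset.sum_add_distrib]
    exact Finset.sum_congr rfl fun u _ => by cases φ u <;> rfl
  induction k with
  | zero =>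
    have : strs 0 = {[]} := by ext s; simp
    simp [blockCount, this]
  | succ k ih =>
    rw [show (k + 1) * m = m + k * m by ring, sum_strs_add, pow_succ', ← ih, ← h1,
      Finset.sum_mul_sum]
    refine Finset.sum_congr rfl fun u hu => Finset.sum_congr rfl fun v _ => ?_
    rw [blockCount_append φ (mem_strs.1 hu), pow_add]

/-- A Chernoff bound: if at most a third of the strings have property `φ`, then the probability that
at least half of `12 e` independent strings have property `φ` is at most `2⁻ᵉ`. -/
theorem cnt_blockCount_le (φ : Str → Bool) (m e : ℕ) (h : 3 * (cnt m fun b => φ b = true) ≤ 2 ^ m) :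
    (cnt (12 * e * m) fun s => 12 * e ≤ 2 * blockCount φ m (12 * e) s) * 2 ^ e ≤
      2 ^ (12 * e * m) := by
  set N := cnt (12 * e * m) fun s => 12 * e ≤ 2 * blockCount φ m (12 * e) s
  -- Markov's inequality for the exponential moment
  have h1 : N * 2 ^ (6 * e) ≤ (2 ^ m + cnt m fun b => φ b = true) ^ (12 * e) := by
    rw [← sum_two_pow_blockCount, ← smul_eq_mul]
    refine (Finset.card_nsmul_le_sum _ _ _ fun s hs => ?_).trans
      (Finset.sum_le_sum_of_subset (Finset.filter_subset _ _))
    exact Nat.pow_le_pow_right (by norm_num) (by have := (Finset.mem_filter.1 hs).2; omega)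
  have h2 : 3 ^ (12 * e) * (2 ^ m + cnt m fun b => φ b = true) ^ (12 * e) ≤
      (4 * 2 ^ m) ^ (12 * e) := by
    rw [← mul_pow]
    exact Nat.pow_le_pow_left (by omega) _
  -- `4 ^ 12 * 2 ≤ 3 ^ 12 * 2 ^ 6`
  have h3 : 4 ^ (12 * e) * 2 ^ e ≤ 3 ^ (12 * e) * 2 ^ (6 * e) := by
    rw [pow_mul, pow_mul, pow_mul, ← mul_pow, ← mul_pow]
    exact Nat.pow_le_pow_left (by norm_num) e
  have h4 : (4 * 2 ^ m) ^ (12 * e) = 4 ^ (12 * e) * 2 ^ (12 * e * m) := by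
    rw [mul_pow, ← pow_mul, mul_comm m]
  rw [h4] at h2
  refine le_of_mul_le_mul_left (a := 3 ^ (12 * e) * 2 ^ (6 * e)) ?_ (by positivity)
  calc 3 ^ (12 * e) * 2 ^ (6 * e) * (N * 2 ^ e)
      = 3 ^ (12 * e) * (N * 2 ^ (6 * e)) * 2 ^ e := by ring
    _ ≤ 4 ^ (12 * e) * 2 ^ (12 * e * m) * 2 ^ e :=
      Nat.mul_le_mul_right _ ((Nat.mul_le_mul_left _ h1).trans h2)
    _ = 4 ^ (12 * e) * 2 ^ e * 2 ^ (12 * e * m) := by ring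
    _ ≤ _ := Nat.mul_le_mul_right _ h3

/-! ### Complexity classes in terms of polynomial-time predicates -/

theorem mem_FP {f : Str → Str} : f ∈ FP ↔ PolyTime f := Iff.rfl

theorem mem_P {L : Lang} : L ∈ P ↔ ∃ χ : Str → Bool, PolyTime χ ∧ ∀ x, x ∈ L ↔ χ x = true := Iff.rfl

theorem setOf_mem_P {χ : Str → Bool} (h : PolyTime χ) : {z | χ z = true} ∈ P :=
  ⟨χ, h, fun _ => Iff.rfl⟩

theorem mem_PEq_of_polyTime {R : Setoid Str} {χ : Str × Str → Bool} (h : PolyTime χ)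
    (hR : ∀ x y, χ (x, y) = true ↔ R x y) : R ∈ PEq :=
  ⟨_, setOf_mem_P (h.comp (PolyTime.left.pair PolyTime.right)), fun x y => by simp [hR]⟩

/-- A language of pairs in `P` is given by a polynomial-time binary predicate. -/
theorem exists_predicate {V : Lang} (hV : V ∈ P) :
    ∃ χ : Str × Str → Bool, PolyTime χ ∧ ∀ x y, pair x y ∈ V ↔ χ (x, y) = true := by
  obtain ⟨χ, h, hχ⟩ := hV
  exact ⟨fun p => χ (pair p.1 p.2), PolyTime.comp h (PolyTime.fst'.pair_str PolyTime.snd'),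
    fun x y => hχ _⟩

theorem exists_verifier {χ : Str × Str → Bool} (h : PolyTime χ) :
    ∃ V ∈ P, ∀ x y, pair x y ∈ V ↔ χ (x, y) = true :=
  ⟨_, setOf_mem_P (h.comp (PolyTime.left.pair PolyTime.right)), fun x y => by simp⟩

theorem acceptProb_eq {V : Lang} {χ : Str × Str → Bool} (h : ∀ x y, pair x y ∈ V ↔ χ (x, y) = true)
    (n : ℕ) (x : Str) : acceptProb V n x = ((cnt n fun r => χ (x, r) = true : ℕ) : ℚ) / 2 ^ n := by
  simp only [acceptProb, h, ncard_eq_cnt]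

theorem mem_NP {L : Lang} : L ∈ NP ↔ ∃ χ : Str × Str → Bool, PolyTime χ ∧ ∃ p : Polynomial ℕ,
    ∀ x, x ∈ L ↔ ∃ y : Str, y.length ≤ p.eval x.length ∧ χ (x, y) = true := by
  constructor
  · rintro ⟨V, hV, p, h⟩
    obtain ⟨χ, hχ, hV⟩ := exists_predicate hV
    exact ⟨χ, hχ, p, fun x => by simp only [h, Witness, hV]⟩
  · rintro ⟨χ, hχ, p, h⟩
    obtain ⟨V, hV, hVχ⟩ := exists_verifier hχ
    exact ⟨V, hV, p, fun x => by simp only [h, Witness, hVχ]⟩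

theorem mem_UP {L : Lang} : L ∈ UP ↔ ∃ χ : Str × Str → Bool, PolyTime χ ∧ ∃ p : Polynomial ℕ,
    ∀ x, (x ∈ L ↔ ∃ y : Str, y.length ≤ p.eval x.length ∧ χ (x, y) = true) ∧
      ∀ y y' : Str, y.length ≤ p.eval x.length → χ (x, y) = true →
        y'.length ≤ p.eval x.length → χ (x, y') = true → y = y' := by
  constructor
  · rintro ⟨V, hV, p, h⟩
    obtain ⟨χ, hχ, hV⟩ := exists_predicate hV
    exact ⟨χ, hχ, p, fun x => by simpa only [Witness, hV, and_imp] using h x⟩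
  · rintro ⟨χ, hχ, p, h⟩
    obtain ⟨V, hV, hVχ⟩ := exists_verifier hχ
    exact ⟨V, hV, p, fun x => by simpa only [Witness, hVχ, and_imp] using h x⟩

theorem mem_RP {L : Lang} : L ∈ RP ↔ ∃ χ : Str × Str → Bool, PolyTime χ ∧ ∃ p : Polynomial ℕ,
    ∀ x, (x ∈ L → 2 ^ p.eval x.length ≤ 2 * cnt (p.eval x.length) fun r => χ (x, r) = true) ∧
      (x ∉ L → (cnt (p.eval x.length) fun r => χ (x, r) = true) = 0) := by
  have key : ∀ (V : Lang) (χ : Str × Str → Bool), (∀ x y, pair x y ∈ V ↔ χ (x, y) = true) →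
      ∀ (n : ℕ) (x : Str), (1 / 2 ≤ acceptProb V n x ↔
        2 ^ n ≤ 2 * cnt n fun r => χ (x, r) = true) ∧
      (acceptProb V n x = 0 ↔ (cnt n fun r => χ (x, r) = true) = 0) := by
    intro V χ h n x
    rw [acceptProb_eq h, div_le_div_iff₀ (by norm_num) (by positivity),
      div_eq_zero_iff, or_iff_left (by positivity)]
    norm_cast
    rw [one_mul, mul_comm]
    exact ⟨Iff.rfl, Iff.rfl⟩
  constructor
  · rintro ⟨V, hV, p, h⟩
    obtain ⟨χ, hχ, hV⟩ := exists_predicate hV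
    exact ⟨χ, hχ, p, fun x => by simpa only [(key V χ hV _ _).1, (key V χ hV _ _).2] using h x⟩
  · rintro ⟨χ, hχ, p, h⟩
    obtain ⟨V, hV, hVχ⟩ := exists_verifier hχ
    exact ⟨V, hV, p, fun x => by simpa only [(key V χ hVχ _ _).1, (key V χ hVχ _ _).2] using h x⟩

open scoped Classical in
/-- `BPP` in terms of the number of random strings on which the answer is wrong. -/
theorem mem_BPP {L : Lang} : L ∈ BPP ↔ ∃ χ : Str × Str → Bool, PolyTime χ ∧ ∃ p : Polynomial ℕ,
    ∀ x, 3 * (cnt (p.eval x.length) fun r => χ (x, r) ≠ decide (x ∈ L)) ≤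
      2 ^ p.eval x.length := by
  have key : ∀ (V : Lang) (χ : Str × Str → Bool), (∀ x y, pair x y ∈ V ↔ χ (x, y) = true) →
      ∀ (n : ℕ) (x : Str), ((x ∈ L → 2 / 3 ≤ acceptProb V n x) ∧
        (x ∉ L → acceptProb V n x ≤ 1 / 3)) ↔
      3 * (cnt n fun r => χ (x, r) ≠ decide (x ∈ L)) ≤ 2 ^ n := by
    intro V χ h n x
    rw [acceptProb_eq h, div_le_div_iff₀ (by norm_num) (by positivity),
      div_le_div_iff₀ (by positivity) (by norm_num)]
    norm_cast
    have := cnt_add_cnt_not (n := n) (P := fun r => χ (x, r) = true)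
    by_cases hx : x ∈ L
    · simp only [hx, not_true, true_imp_iff, false_imp_iff, and_true, decide_true]
      omega
    · simp only [hx, not_false_eq_true, true_imp_iff, false_imp_iff, true_and, decide_false,
        Bool.not_eq_false]
      omega
  constructor
  · rintro ⟨V, hV, p, h⟩
    obtain ⟨χ, hχ, hV⟩ := exists_predicate hV
    exact ⟨χ, hχ, p, fun x => (key V χ hV _ _).1 (h x)⟩
  · rintro ⟨χ, hχ, p, h⟩
    obtain ⟨V, hV, hVχ⟩ := exists_verifier hχ
    exact ⟨V, hV, p, fun x => (key V χ hVχ _ _).2 (h x)⟩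

/-! ### Consequences of canonical forms -/

theorem IsCanonicalForm.idem {R : Setoid Str} {c : Str → Str} (hc : IsCanonicalForm R c) (z : Str) :
    c (c z) = c z :=
  (hc.2 _ _ (hc.1 z)).symm

/-- If every equivalence relation in `PEq` has a canonical form in `FP`, then `NP ⊆ UP`: call two
pairs of an input and a witness equivalent if they belong to the same input, and accept only those
witnesses that the canonical form chooses. -/
theorem NP_subset_UP (h : PEq ⊆ CF) : NP ⊆ UP := by
  intro L hL
  obtain ⟨χ, hχ, p, hL⟩ := mem_NP.1 hL
  set W : Str → Bool := fun z => decide (z = pair (left z) (right z)) &&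
    (decide ((right z).length ≤ p.eval (left z).length) && χ (left z, right z)) with hW
  have hWP : PolyTime W :=
    (PolyTime.id'.eq_str (PolyTime.left.pair_str PolyTime.right)).and
      ((PolyTime.right.length.le (PolyTime.left.length.eval p)).and
        (hχ.comp (PolyTime.left.pair PolyTime.right)))
  have hWpair : ∀ x y, W (pair x y) = true ↔ y.length ≤ p.eval x.length ∧ χ (x, y) = true :=
    fun x y => by simp [hW]
  have hWeq : ∀ z, W z = true → z = pair (left z) (right z) := fun z hz => by
    simp only [hW, Bool.and_eq_true, decide_eq_true_eq] at hz
    exact hz.1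
  let R : Setoid Str :=
    { r := fun s t => s = t ∨ W s = true ∧ W t = true ∧ left s = left t
      iseqv :=
        { refl := fun s => .inl rfl
          symm := by
            rintro s t (rfl | ⟨h1, h2, h3⟩)
            · exact .inl rfl
            · exact .inr ⟨h2, h1, h3.symm⟩
          trans := by
            rintro s t u (rfl | ⟨h1, h2, h3⟩) (rfl | ⟨h4, h5, h6⟩)
            · exact .inl rfl
            · exact .inr ⟨h4, h5, h6⟩
            · exact .inr ⟨h1, h2, h3⟩
            · exact .inr ⟨h1, h5, h3.trans h6⟩ } }
  have hRdef : ∀ s t, R s t ↔ s = t ∨ W s = true ∧ W t = true ∧ left s = left t :=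
    fun _ _ => Iff.rfl
  have hR : R ∈ PEq := mem_PEq_of_polyTime
    (χ := fun q => decide (q.1 = q.2) || (W q.1 && (W q.2 && decide (left q.1 = left q.2))))
    ((PolyTime.fst'.eq_str PolyTime.snd').or ((hWP.comp PolyTime.fst').and
      ((hWP.comp PolyTime.snd').and
        ((PolyTime.left.comp PolyTime.fst').eq_str (PolyTime.left.comp PolyTime.snd')))))
    fun s t => by simp [hRdef]
  obtain ⟨c, hcP, hc⟩ := h hR
  rw [mem_FP] at hcP
  refine mem_UP.2 ⟨fun q => W (pair q.1 q.2) && decide (c (pair q.1 q.2) = pair q.1 q.2),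
    PolyTime.and (hWP.comp (PolyTime.fst'.pair_str PolyTime.snd'))
      (PolyTime.eq_str (hcP.comp (PolyTime.fst'.pair_str PolyTime.snd'))
        (PolyTime.fst'.pair_str PolyTime.snd')), p, fun x => ⟨?_, ?_⟩⟩
  · rw [hL]
    constructor
    · rintro ⟨y, hy, hxy⟩
      have h1 : W (pair x y) = true := (hWpair x y).2 ⟨hy, hxy⟩
      -- the canonical form of a pair of `x` and a witness is another such pair
      have h2 : W (c (pair x y)) = true ∧ left (c (pair x y)) = x := by
        rcases (hRdef _ _).1 (hc.1 (pair x y)) with h | ⟨-, h, h'⟩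
        · rw [← h]; exact ⟨h1, left_pair x y⟩
        · exact ⟨h, by rw [← h', left_pair]⟩
      have h3 := hWeq _ h2.1
      rw [h2.2] at h3
      have h4 := (hWpair x (right (c (pair x y)))).1 (h3 ▸ h2.1)
      refine ⟨right (c (pair x y)), h4.1, ?_⟩
      simp only [Bool.and_eq_true, decide_eq_true_eq]
      rw [← h3]
      exact ⟨h2.1, hc.idem _⟩
    · rintro ⟨y, hy, hxy⟩
      simp only [Bool.and_eq_true] at hxy
      exact ⟨y, (hWpair x y).1 hxy.1⟩
  · intro y y' _ h1 _ h2
    simp only [Bool.and_eq_true, decide_eq_true_eq] at h1 h2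
    have h3 := hc.2 _ _ ((hRdef _ _).2 (.inr ⟨h1.1, h2.1, by simp⟩))
    rw [h1.2, h2.2] at h3
    exact (pair_inj.1 h3).2

theorem eq_replicate_append_unpad {d : Str} (h : d.contains true = true) :
    ∃ k, d = List.replicate k false ++ true :: unpad d := by
  induction d with
  | nil => simp at h
  | cons b d ih =>
    cases b with
    | false =>
      obtain ⟨k, hk⟩ := ih (by simpa using h)
      exact ⟨k + 1, by rw [unpad_false, List.replicate_succ, List.cons_append, ← hk]⟩
    | true => exact ⟨0, by simp [unpad_true]⟩

theorem contains_true_bxor_self (r : Str) : (bxor r r).contains true = false := by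
  induction r with
  | nil => rfl
  | cons b r ih => cases b <;> simp_all

/-- If every equivalence relation in `PEq` has a canonical form in `FP`, then `UP ⊆ RP`. Witnesses
are padded to nonzero strings `d` of a fixed length `n`. For an input `x` that has a witness, the
strings of length `n` fall into classes `{u, u ⊕ d}`, and this partition is recognized in
polynomial time because the witness is unique. With probability one half, a random string is not
the canonical element of its class; this never happens if `x` has no witness. -/
theorem UP_subset_RP (h : PEq ⊆ CF) : UP ⊆ RP := by
  intro L hL
  obtain ⟨χ, hχ, p, hL⟩ := mem_UP.1 hL
  -- `mask (x, d)`: `d` is a padded witness for `x`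
  set mask : Str × Str → Bool := fun q => decide (q.2.length = p.eval q.1.length + 1) &&
    (q.2.contains true && χ (q.1, unpad q.2)) with hmask
  have hmaskP : PolyTime mask :=
    ((PolyTime.length PolyTime.snd').eq_nat (((PolyTime.length PolyTime.fst').eval p).succ)).and
      ((PolyTime.contains_true PolyTime.snd').and
        (hχ.comp (PolyTime.fst'.pair (PolyTime.unpad PolyTime.snd'))))
  have hmask' : ∀ x d, mask (x, d) = true ↔
      d.length = p.eval x.length + 1 ∧ d.contains true = true ∧ χ (x, unpad d) = true :=
    fun x d => by simp [hmask]
  have hunpad : ∀ x d, mask (x, d) = true → (unpad d).length ≤ p.eval x.length := by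
    intro x d hd
    obtain ⟨h1, h2, -⟩ := (hmask' x d).1 hd
    obtain ⟨k, hk⟩ := eq_replicate_append_unpad h2
    have := congrArg List.length hk
    simp at this
    omega
  have huniq : ∀ x d d', mask (x, d) = true → mask (x, d') = true → d = d' := by
    intro x d d' hd hd'
    have h1 := (hL x).2 _ _ (hunpad x d hd) ((hmask' x d).1 hd).2.2 (hunpad x d' hd')
      ((hmask' x d').1 hd').2.2
    obtain ⟨k, hk⟩ := eq_replicate_append_unpad ((hmask' x d).1 hd).2.1
    obtain ⟨k', hk'⟩ := eq_replicate_append_unpad ((hmask' x d').1 hd').2.1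
    have h2 : d.length = d'.length :=
      ((hmask' x d).1 hd).1.trans ((hmask' x d').1 hd').1.symm
    rw [h1] at hk
    have h3 : k = k' := by
      have e1 := congrArg List.length hk
      have e2 := congrArg List.length hk'
      simp only [List.length_append, List.length_replicate, List.length_cons] at e1 e2
      omega
    rw [hk, hk', h3]
    simp [unpad_replicate]
  set ok : Str → Bool := fun z => decide (z = pair (left z) (right z)) &&
    decide ((right z).length = p.eval (left z).length + 1) with hok
  have hokP : PolyTime ok :=
    (PolyTime.id'.eq_str (PolyTime.left.pair_str PolyTime.right)).and
      (PolyTime.right.length.eq_nat (PolyTime.left.length.eval p).succ)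
  have hok' : ∀ z, ok z = true ↔
      z = pair (left z) (right z) ∧ (right z).length = p.eval (left z).length + 1 :=
    fun z => by simp [hok]
  let R : Setoid Str :=
    { r := fun s t => s = t ∨ ok s = true ∧ ok t = true ∧ left s = left t ∧
        mask (left s, bxor (right s) (right t)) = true
      iseqv :=
        { refl := fun s => .inl rfl
          symm := by
            rintro s t (rfl | ⟨h1, h2, h3, h4⟩)
            · exact .inl rfl
            · exact .inr ⟨h2, h1, h3.symm, by rwa [← h3, bxor_comm]⟩
          trans := by
            rintro s t u (rfl | ⟨h1, h2, h3, h4⟩) (rfl | ⟨h5, h6, h7, h8⟩)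
            · exact .inl rfl
            · exact .inr ⟨h5, h6, h7, h8⟩
            · exact .inr ⟨h1, h2, h3, h4⟩
            · -- both masks are the unique padded witness `d`, and `u = s ⊕ d ⊕ d = s`
              refine .inl ?_
              rw [← h3] at h8 h7
              have h9 := huniq _ _ _ h4 h8
              obtain ⟨e1, l1⟩ := (hok' s).1 h1
              obtain ⟨e2, l2⟩ := (hok' t).1 h2
              obtain ⟨e3, l3⟩ := (hok' u).1 h6
              rw [← h3] at l2
              rw [← h7] at l3
              have h10 : right u = right s := by
                rw [← bxor_bxor (l2.trans l3.symm), ← h9, bxor_comm (right s),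
                  bxor_bxor (l2.trans l1.symm)]
              rw [e1, e3, h10, h7] } }
  have hRdef : ∀ s t, R s t ↔ s = t ∨ ok s = true ∧ ok t = true ∧ left s = left t ∧
      mask (left s, bxor (right s) (right t)) = true := fun _ _ => Iff.rfl
  have hl1 : PolyTime fun q : Str × Str => left q.1 := PolyTime.left.comp PolyTime.fst'
  have hR : R ∈ PEq := mem_PEq_of_polyTime
    (χ := fun q => decide (q.1 = q.2) || (ok q.1 && (ok q.2 && (decide (left q.1 = left q.2) &&
      mask (left q.1, bxor (right q.1) (right q.2))))))
    ((PolyTime.fst'.eq_str PolyTime.snd').or ((hokP.comp PolyTime.fst').and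
      ((hokP.comp PolyTime.snd').and ((hl1.eq_str (PolyTime.left.comp PolyTime.snd')).and
        (hmaskP.comp (hl1.pair ((PolyTime.right.comp PolyTime.fst').zipWith_xor
          (PolyTime.right.comp PolyTime.snd'))))))))
    fun s t => by simp [hRdef]
  obtain ⟨c, hcP, hc⟩ := h hR
  rw [mem_FP] at hcP
  refine mem_RP.2 ⟨fun q => !decide (c (pair q.1 q.2) = pair q.1 q.2),
    PolyTime.not (PolyTime.eq_str (hcP.comp (PolyTime.fst'.pair_str PolyTime.snd'))
      (PolyTime.fst'.pair_str PolyTime.snd')), p + 1, fun x => ⟨fun hx => ?_, fun hx => ?_⟩⟩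
  · obtain ⟨y, hy, hxy⟩ := (hL x).1.1 hx
    rw [Polynomial.eval_add, Polynomial.eval_one]
    set n := p.eval x.length + 1 with hn
    set d : Str := List.replicate (p.eval x.length - y.length) false ++ true :: y with hd
    have hdlen : d.length = n := by simp [hd, hn]; omega
    have hdm : mask (x, d) = true :=
      (hmask' x d).2 ⟨hdlen, by simp [hd], by rw [hd, unpad_replicate]; exact hxy⟩
    have key : ∀ r : Str, r.length = n → ¬ ((!decide (c (pair x r) = pair x r)) = true) →
        (!decide (c (pair x (bxor d r)) = pair x (bxor d r))) = true := by
      intro r hr h1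
      simp only [Bool.not_eq_true', decide_eq_false_iff_not, not_not] at h1 ⊢
      intro h2
      have hrd : bxor r (bxor d r) = d := by
        rw [bxor_comm d, bxor_bxor (hr.trans hdlen.symm)]
      have h3 : R (pair x r) (pair x (bxor d r)) := by
        refine (hRdef _ _).2 (.inr ⟨(hok' _).2 ?_, (hok' _).2 ?_, by simp, ?_⟩)
        · simp [hr, hn]
        · simp [hr, hdlen, hn]
        · simpa [hrd] using hdm
      have h4 := hc.2 _ _ h3
      rw [h1, h2] at h4
      have h5 := (pair_inj.1 h4).2
      rw [← h5] at hrd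
      have h6 := ((hmask' x d).1 hdm).2.1
      rw [← hrd, contains_true_bxor_self] at h6
      cases h6
    have h1 := cnt_mono (n := n) key
    rw [cnt_bxor (P := fun r => (!decide (c (pair x r) = pair x r)) = true) hdlen] at h1
    have h2 := cnt_add_cnt_not (n := n) (P := fun r => (!decide (c (pair x r) = pair x r)) = true)
    change 2 ^ n ≤ 2 * cnt n fun r => (!decide (c (pair x r) = pair x r)) = true
    omega
  · rw [cnt, Finset.card_eq_zero, Finset.filter_eq_empty_iff]
    intro r _ h1
    simp only [Bool.not_eq_true', decide_eq_false_iff_not] at h1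
    rcases (hRdef _ _).1 (hc.1 (pair x r)) with h2 | ⟨-, -, -, h2⟩
    · exact h1 h2.symm
    · rw [left_pair] at h2
      exact hx ((hL x).1.2 ⟨_, hunpad _ _ h2, ((hmask' _ _).1 h2).2.2⟩)

/-! ### Inclusions between complexity classes -/

theorem UP_subset_NP : UP ⊆ NP := fun _ ⟨V, hV, p, h⟩ => ⟨V, hV, p, fun x => (h x).1⟩

theorem RP_subset_NP : RP ⊆ NP := by
  intro L hL
  obtain ⟨χ, hχ, p, hL⟩ := mem_RP.1 hL
  refine mem_NP.2 ⟨fun q => decide (q.2.length = p.eval q.1.length) && χ q,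
    (PolyTime.eq_nat (PolyTime.length PolyTime.snd')
      ((PolyTime.length PolyTime.fst').eval p)).and hχ, p, fun x => ?_⟩
  constructor
  · intro hx
    have h1 := (hL x).1 hx
    have h2 : 0 < cnt (p.eval x.length) fun r => χ (x, r) = true := by
      have : 0 < 2 ^ p.eval x.length := by positivity
      omega
    obtain ⟨r, hr⟩ := Finset.card_pos.1 h2
    simp only [Finset.mem_filter, mem_strs] at hr
    exact ⟨r, hr.1.le, by simp [hr.1, hr.2]⟩
  · rintro ⟨y, -, hy⟩
    simp only [Bool.and_eq_true, decide_eq_true_eq] at hy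
    by_contra hx
    have h1 := (hL x).2 hx
    rw [cnt, Finset.card_eq_zero, Finset.filter_eq_empty_iff] at h1
    exact h1 (mem_strs.2 hy.1) hy.2

theorem compl_mem_P {L : Lang} (h : L ∈ P) : Lᶜ ∈ P := by
  obtain ⟨χ, hχ, hL⟩ := mem_P.1 h
  exact ⟨fun x => !χ x, PolyTime.not hχ, fun x => by simp [hL]⟩

theorem NP_subset_SigmaP_one : NP ⊆ SigmaP 1 :=
  fun _ ⟨V, hV, p, h⟩ => ⟨V, compl_mem_P hV, p, h⟩

theorem P_subset_BPP : P ⊆ BPP := by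
  classical
  intro L hL
  obtain ⟨χ, hχ, hL⟩ := mem_P.1 hL
  refine mem_BPP.2 ⟨fun q => χ q.1, PolyTime.comp hχ PolyTime.fst', 0, fun x => ?_⟩
  simp [cnt, hL]

theorem compl_mem_BPP {L : Lang} (h : L ∈ BPP) : Lᶜ ∈ BPP := by
  classical
  obtain ⟨χ, hχ, p, hL⟩ := mem_BPP.1 h
  refine mem_BPP.2 ⟨fun q => !χ q, PolyTime.not hχ, p, fun x => ?_⟩
  rw [cnt_congr (Q := fun r => χ (x, r) ≠ decide (x ∈ L)) fun r _ => by simp]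
  exact hL x

/-- Two independent trials reduce the error probability from `1 / 2` to `1 / 4`. -/
theorem RP_subset_BPP : RP ⊆ BPP := by
  classical
  intro L hL
  obtain ⟨χ, hχ, p, hL⟩ := mem_RP.1 hL
  have hm : PolyTime fun q : Str × Str => p.eval q.1.length :=
    (PolyTime.length PolyTime.fst').eval p
  refine mem_BPP.2 ⟨fun q => χ (q.1, q.2.take (p.eval q.1.length)) ||
    χ (q.1, q.2.drop (p.eval q.1.length)),
    (hχ.comp (PolyTime.fst'.pair (hm.take PolyTime.snd'))).or
      (hχ.comp (PolyTime.fst'.pair (hm.drop PolyTime.snd'))), p + p, fun x => ?_⟩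
  rw [Polynomial.eval_add]
  set m := p.eval x.length
  by_cases hx : x ∈ L
  · have h1 := (hL x).1 hx
    have h2 := cnt_add_cnt_not (n := m) (P := fun r => χ (x, r) = true)
    set N := cnt m fun r => ¬ χ (x, r) = true with hN
    have h3 : (cnt (m + m) fun r => (χ (x, r.take m) || χ (x, r.drop m)) ≠ decide (x ∈ L)) =
        N * N := by
      rw [cnt_eq_sum, sum_strs_add, hN, cnt_eq_sum, Finset.sum_mul_sum]
      refine Finset.sum_congr rfl fun u hu => Finset.sum_congr rfl fun v _ => ?_
      rw [mem_strs] at hu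
      simp only [← hu, List.take_left, List.drop_left, hx, decide_true]
      cases χ (x, u) <;> cases χ (x, v) <;> rfl
    rw [h3, pow_add]
    have h4 : 2 * N ≤ 2 ^ m := by change 2 ^ m ≤ 2 * cnt m _ at h1; omega
    nlinarith [Nat.mul_le_mul h4 h4]
  · have h1 : (cnt m fun r => χ (x, r) = true) = 0 := (hL x).2 hx
    rw [cnt, Finset.card_eq_zero, Finset.filter_eq_empty_iff] at h1
    have h3 : (cnt (m + m) fun r => (χ (x, r.take m) || χ (x, r.drop m)) ≠ decide (x ∈ L)) = 0 := by
      rw [cnt, Finset.card_eq_zero, Finset.filter_eq_empty_iff]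
      intro r hr
      rw [mem_strs] at hr
      have h4 := h1 (x := r.take m) (mem_strs.2 (by simp; omega))
      have h5 := h1 (x := r.drop m) (mem_strs.2 (by simp; omega))
      simp [hx, h4, h5]
    exact (congrArg (3 * ·) h3).trans_le (Nat.zero_le _)

open scoped Classical in
/-- The majority of sufficiently many trials has exponentially small error probability. Unused
random bits do no harm. -/
theorem exists_amplified {L : Lang} (hL : L ∈ BPP) (e : Polynomial ℕ) :
    ∃ χ : Str × Str → Bool, PolyTime χ ∧ ∃ q : Polynomial ℕ, ∀ x : Str, ∀ N ≥ q.eval x.length,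
      (cnt N fun r => χ (x, r) ≠ decide (x ∈ L)) * 2 ^ e.eval x.length ≤ 2 ^ N := by
  obtain ⟨χ, hχ, p, hL⟩ := mem_BPP.1 hL
  set m : Str → ℕ := fun x => p.eval x.length with hm
  set k : Str → ℕ := fun x => 12 * e.eval x.length with hk
  have hmP : PolyTime fun q : Str × Str => m q.1 := (PolyTime.length PolyTime.fst').eval p
  have hkP : PolyTime fun q : Str × Str => k q.1 :=
    (PolyTime.const 12).mul ((PolyTime.length PolyTime.fst').eval e)
  refine ⟨fun q => decide (k q.1 < 2 * blockCount (fun b => χ (q.1, b)) (m q.1) (k q.1)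
    (q.2.take (k q.1 * m q.1))), hkP.lt ((PolyTime.const 2).mul (PolyTime.blockCount hχ
      PolyTime.fst' hmP hkP ((hkP.mul hmP).take PolyTime.snd'))), 12 * e * p, fun x N hN => ?_⟩
  obtain ⟨N', rfl⟩ : ∃ N', N = k x * m x + N' := by
    refine ⟨N - k x * m x, ?_⟩
    simp [hk, hm] at hN ⊢
    omega
  rw [cnt_take (P := fun s => decide (k x < 2 * blockCount (fun b => χ (x, b)) (m x) (k x) s) ≠
    decide (x ∈ L)), pow_add, mul_right_comm]
  refine Nat.mul_le_mul_right _ (le_trans (Nat.mul_le_mul_right _ (cnt_mono ?_))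
    (cnt_blockCount_le (fun b => χ (x, b) != decide (x ∈ L)) (m x) (e.eval x.length) ?_))
  · intro s _ hs
    change k x ≤ 2 * blockCount _ _ (k x) _
    by_cases hx : x ∈ L
    · have := blockCount_not (fun b => χ (x, b)) (m x) (k x) s
      simp only [hx, decide_true, ne_eq, decide_eq_true_eq, not_lt] at hs
      simp only [hx, decide_true, Bool.bne_true]
      omega
    · simp only [hx, decide_false, ne_eq, decide_eq_false_iff_not, not_not] at hs
      simp only [hx, decide_false, Bool.bne_false]
      exact hs.le
  · simpa using hL x

/-- The strings of length at most `n`. -/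
def strsLe (n : ℕ) : Finset Str := (Finset.range (n + 1)).biUnion strs

theorem mem_strsLe {n : ℕ} {s : Str} : s ∈ strsLe n ↔ s.length ≤ n := by
  simp [strsLe]

theorem card_strsLe (n : ℕ) : (strsLe n).card ≤ 2 ^ (n + 1) := by
  refine Finset.card_biUnion_le.trans ?_
  simp only [card_strs]
  exact (Nat.geomSum_lt le_rfl fun i hi => Finset.mem_range.1 hi).le

/-- If `NP ⊆ BPP`, then `BPP` is closed under polynomially bounded existential quantification. After
amplification, most random strings `r` give the right answer for all the possible witnesses at
once; given such an `r`, the existence of a witness is a question in `NP`. -/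
theorem exists_mem_BPP (h : NP ⊆ BPP) {V : Lang} (hV : V ∈ BPP) (p : Polynomial ℕ) {L : Lang}
    (hL : ∀ x, x ∈ L ↔ ∃ y, Witness V p x y) : L ∈ BPP := by
  classical
  obtain ⟨χ, hχ, q, hq⟩ := exists_amplified hV (p + 5)
  set A : Lang := {z | ∃ y : Str, y.length ≤ p.eval (left z).length ∧
    χ (pair (left z) y, right z) = true} with hA
  have hANP : A ∈ NP := by
    obtain ⟨q₀, hq₀⟩ := PolyTime.left.size_le
    refine mem_NP.2 ⟨fun w => decide (w.2.length ≤ p.eval (left w.1).length) &&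
      χ (pair (left w.1) w.2, right w.1),
      ((PolyTime.length PolyTime.snd').le
        ((PolyTime.length (PolyTime.left.comp PolyTime.fst')).eval p)).and
        (hχ.comp (((PolyTime.left.comp PolyTime.fst').pair_str PolyTime.snd').pair
          (PolyTime.right.comp PolyTime.fst'))), p.comp q₀, fun z => ?_⟩
    simp only [hA, Set.mem_ofPred_eq, Bool.and_eq_true, decide_eq_true_eq, Polynomial.eval_comp]
    constructor
    · rintro ⟨y, hy, hzy⟩
      exact ⟨y, hy.trans (polynomial_eval_mono p (hq₀ z)), hy, hzy⟩
    · rintro ⟨y, -, hy, hzy⟩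
      exact ⟨y, hy, hzy⟩
  obtain ⟨χA, hχA, qA, hqA⟩ := exists_amplified (h hANP) 4
  set N₁ : Polynomial ℕ := q.comp (2 * .X + 2 + p) with hN₁
  set N₂ : Polynomial ℕ := qA.comp (2 * .X + 2 + N₁) with hN₂
  have hmP : PolyTime fun w : Str × Str => N₁.eval w.1.length :=
    (PolyTime.length PolyTime.fst').eval N₁
  refine mem_BPP.2 ⟨fun w => χA (pair w.1 (w.2.take (N₁.eval w.1.length)),
    w.2.drop (N₁.eval w.1.length)),
    hχA.comp ((PolyTime.fst'.pair_str (hmP.take PolyTime.snd')).pair (hmP.drop PolyTime.snd')),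
    N₁ + N₂, fun x => ?_⟩
  rw [Polynomial.eval_add]
  set a := N₁.eval x.length with ha
  set b := N₂.eval x.length with hb
  set n := p.eval x.length with hn
  -- the random strings that are wrong about some candidate for a witness
  set bad : Str → Prop := fun u => ∃ y ∈ strsLe n, χ (pair x y, u) ≠ decide (pair x y ∈ V)
    with hbad
  have hbad_le : cnt a bad * 16 ≤ 2 ^ a := by
    have h1 : ∀ y ∈ strsLe n, (cnt a fun u => χ (pair x y, u) ≠ decide (pair x y ∈ V)) ≤
        2 ^ a / 2 ^ (n + 5) := by
      intro y hy
      rw [mem_strsLe] at hy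
      rw [Nat.le_div_iff_mul_le (by positivity)]
      refine le_trans (Nat.mul_le_mul_left _ (Nat.pow_le_pow_right (by norm_num) ?_))
        (hq (pair x y) a ?_)
      · have := polynomial_eval_mono p (show x.length ≤ (pair x y).length by
          rw [length_pair]; omega)
        simpa using this
      · rw [ha, hN₁, Polynomial.eval_comp]
        refine polynomial_eval_mono q ?_
        rw [length_pair]
        simpa using hy
    have h2 := (cnt_exists_le (strsLe n) h1).trans (Nat.mul_le_mul_right _ (card_strsLe n))
    calc cnt a bad * 16 ≤ 2 ^ (n + 1) * (2 ^ a / 2 ^ (n + 5)) * 16 := Nat.mul_le_mul_right _ h2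
      _ = 2 ^ a / 2 ^ (n + 5) * 2 ^ (n + 5) := by ring
      _ ≤ 2 ^ a := Nat.div_mul_le_self _ _
  have hgood : ∀ u, ¬ bad u → (pair x u ∈ A ↔ x ∈ L) := by
    intro u hu
    simp only [hbad, not_exists, not_and, not_not, mem_strsLe] at hu
    simp only [hA, Set.mem_ofPred_eq, left_pair, right_pair, hL, Witness]
    refine exists_congr fun y => and_congr_right fun hy => ?_
    rw [hu y hy, decide_eq_true_eq]
  have hA_le : ∀ u : Str, u.length = a →
      (cnt b fun v => χA (pair x u, v) ≠ decide (pair x u ∈ A)) ≤ 2 ^ b / 16 := by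
    intro u hu
    rw [Nat.le_div_iff_mul_le (by norm_num)]
    refine le_trans (le_of_eq ?_) (hqA (pair x u) b ?_)
    · norm_num
    · rw [hb, hN₂, Polynomial.eval_comp, length_pair, hu]
      simp [ha]
  have h1 : (cnt (a + b) fun r => χA (pair x (r.take a), r.drop a) ≠ decide (x ∈ L)) ≤
      cnt a bad * 2 ^ b + 2 ^ a * (2 ^ b / 16) := by
    rw [← cnt_take]
    refine le_trans (cnt_mono ?_) (cnt_or_le.trans (Nat.add_le_add_left (cnt_append_le
      (R := fun u v => χA (pair x u, v) ≠ decide (pair x u ∈ A)) a b _ hA_le) _))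
    intro r _ hr
    by_cases hb : bad (r.take a)
    · exact .inl hb
    · exact .inr (by simpa [hgood _ hb] using hr)
  have h2 : cnt a bad * 16 * 2 ^ b ≤ 2 ^ a * 2 ^ b := Nat.mul_le_mul_right _ hbad_le
  have h3 : 2 ^ a * (2 ^ b / 16 * 16) ≤ 2 ^ a * 2 ^ b :=
    Nat.mul_le_mul_left _ (Nat.div_mul_le_self _ _)
  rw [pow_add]
  nlinarith

theorem SigmaP_subset_BPP (h : NP ⊆ BPP) (k : ℕ) : SigmaP k ⊆ BPP := by
  induction k with
  | zero => exact P_subset_BPP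
  | succ k ih =>
    rintro L ⟨V, hV, p, hL⟩
    exact exists_mem_BPP h (by simpa using compl_mem_BPP (ih hV)) p hL

theorem sum_blockCount_bxor (φ : Str → Bool) (m k : ℕ) {s : Str} (hs : s.length = k * m) :
    ∑ r ∈ strs m, blockCount (fun b => φ (bxor r b)) m k s = k * cnt m fun b => φ b = true := by
  induction k generalizing s with
  | zero => simp [blockCount]
  | succ k ih =>
    rw [Nat.succ_mul] at hs
    simp only [blockCount]
    rw [Finset.sum_add_distrib, ih (by simp; omega), add_one_mul, add_comm]
    congr 1
    rw [← cnt_bxor (r := s.take m) (by simp; omega), cnt_eq_sum]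
    refine Finset.sum_congr rfl fun r _ => ?_
    rw [bxor_comm]
    cases φ (bxor (s.take m) r) <;> rfl

/-- `BPP` lies in the second level of the polynomial hierarchy: `x ∈ L` if and only if there are
strings `s₁, …, sₖ` such that for every string `r` the majority of the random strings `r ⊕ sᵢ` leads
to acceptance. If `x ∈ L`, most choices of the `sᵢ` work for all `r`, by the Chernoff bound; if
`x ∉ L`, at most a third of the `r ⊕ sᵢ` lead to acceptance for `r` random. -/
theorem BPP_subset_SigmaP_two : BPP ⊆ SigmaP 2 := by
  classical
  intro L hL
  obtain ⟨χ, hχ, p, hL⟩ := mem_BPP.1 hL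
  set m : Str → ℕ := fun x => p.eval x.length with hm
  set k : Str → ℕ := fun x => 12 * (m x + 1) with hk
  have hmP : PolyTime m := (PolyTime.length PolyTime.id').eval p
  have hkP : PolyTime k := (PolyTime.const 12).mul hmP.succ
  have hk0 : ∀ x, 0 < k x := fun x => by simp [hk]
  -- `maj ((x, r), s)`: the majority of the strings `r ⊕ sᵢ` leads to acceptance
  set maj : (Str × Str) × Str → Bool := fun w => decide (k w.1.1 <
    2 * blockCount (fun b => χ (w.1.1, bxor w.1.2 b)) (m w.1.1) (k w.1.1) w.2) with hmaj
  have hx : PolyTime fun w : (Str × Str) × Str => w.1.1 := PolyTime.fst PolyTime.fst'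
  have hmajP : PolyTime maj :=
    (hkP.comp hx).lt ((PolyTime.const 2).mul (PolyTime.blockCount
      (φ := fun w : (Str × Str) × Str => χ (w.1.1, bxor w.1.2 w.2))
      (hχ.comp (hx.pair ((PolyTime.snd PolyTime.fst').zipWith_xor PolyTime.snd')))
      PolyTime.fst' (hmP.comp hx) (hkP.comp hx) PolyTime.snd'))
  have hmaj' : ∀ x r s, maj ((x, r), s) = true ↔
      k x < 2 * blockCount (fun b => χ (x, bxor r b)) (m x) (k x) s := fun x r s => by simp [hmaj]
  set V : Lang := {z | (right z).length = k (left z) * m (left z) ∧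
    ∀ r : Str, r.length = m (left z) → maj ((left z, r), right z) = true} with hVdef
  have hV : Vᶜ ∈ NP := by
    obtain ⟨q₀, hq₀⟩ := PolyTime.left.size_le
    have hl : PolyTime fun w : Str × Str => left w.1 := PolyTime.left.comp PolyTime.fst'
    have hr : PolyTime fun w : Str × Str => right w.1 := PolyTime.right.comp PolyTime.fst'
    refine mem_NP.2 ⟨fun w => !decide ((right w.1).length = k (left w.1) * m (left w.1)) ||
      (decide (w.2.length = m (left w.1)) && !maj ((left w.1, w.2), right w.1)),
      (hr.length.eq_nat ((hkP.comp hl).mul (hmP.comp hl))).not.or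
        (((PolyTime.length PolyTime.snd').eq_nat (hmP.comp hl)).and
          (hmajP.comp ((hl.pair PolyTime.snd').pair hr)).not), p.comp q₀, fun z => ?_⟩
    simp only [hVdef, Set.mem_compl_iff, Set.mem_ofPred_eq, not_and_or, not_forall, Bool.or_eq_true,
      Bool.not_eq_true', decide_eq_false_iff_not, Bool.and_eq_true, decide_eq_true_eq,
      Polynomial.eval_comp, Bool.not_eq_true]
    constructor
    · rintro (h | ⟨r, hr, h⟩)
      · exact ⟨[], Nat.zero_le _, .inl h⟩
      · exact ⟨r, hr.trans_le (polynomial_eval_mono p (hq₀ z)), .inr ⟨hr, h⟩⟩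
    · rintro ⟨r, -, h | ⟨hr, h⟩⟩
      · exact .inl h
      · exact .inr ⟨r, hr, h⟩
  refine ⟨V, NP_subset_SigmaP_one hV, 12 * (p + 1) * p, fun x => ?_⟩
  have hlen : (12 * (p + 1) * p).eval x.length = k x * m x := by simp [hk, hm]
  simp only [Witness, hlen, hVdef, Set.mem_ofPred_eq, left_pair, right_pair]
  have hLx := hL x
  change 3 * cnt (m x) _ ≤ 2 ^ m x at hLx
  constructor
  · intro hxL
    simp only [hxL, decide_true, ne_eq, Bool.not_eq_true] at hLx
    have h1 : ∀ r ∈ strs (m x), (cnt (k x * m x) fun s =>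
        k x ≤ 2 * blockCount (fun b => !χ (x, bxor r b)) (m x) (k x) s) ≤
          2 ^ (k x * m x) / 2 ^ (m x + 1) := by
      intro r hr
      rw [mem_strs] at hr
      rw [Nat.le_div_iff_mul_le (by positivity)]
      refine cnt_blockCount_le _ _ _ ?_
      rw [cnt_bxor (P := fun b => (!χ (x, b)) = true) hr]
      simpa using hLx
    have h2 := cnt_exists_le (strs (m x)) h1
    rw [card_strs] at h2
    have h3 : 2 ^ m x * (2 ^ (k x * m x) / 2 ^ (m x + 1)) * 2 ≤ 2 ^ (k x * m x) :=
      calc _ = 2 ^ (k x * m x) / 2 ^ (m x + 1) * 2 ^ (m x + 1) := by ring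
        _ ≤ _ := Nat.div_mul_le_self _ _
    have h4 : 0 < 2 ^ (k x * m x) := by positivity
    obtain ⟨s, hs, hs'⟩ := exists_of_cnt_lt (lt_of_le_of_lt h2 (by omega))
    refine ⟨s, hs.le, hs, fun r hr => (hmaj' _ _ _).2 ?_⟩
    have h5 : ¬ k x ≤ 2 * blockCount (fun b => !χ (x, bxor r b)) (m x) (k x) s :=
      fun h => hs' ⟨r, mem_strs.2 hr, h⟩
    have h6 := blockCount_not (fun b => χ (x, bxor r b)) (m x) (k x) s
    omega
  · rintro ⟨s, -, hs, hall⟩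
    by_contra hxL
    simp only [hxL, decide_false, ne_eq, Bool.not_eq_false] at hLx
    have h1 := sum_blockCount_bxor (fun b => χ (x, b)) (m x) (k x) hs
    have h2 : 2 ^ m x * k x ≤
        2 * ∑ r ∈ strs (m x), blockCount (fun b => χ (x, bxor r b)) (m x) (k x) s := by
      rw [← card_strs, ← smul_eq_mul, Finset.mul_sum]
      exact Finset.card_nsmul_le_sum _ _ _ fun r hr =>
        ((hmaj' _ _ _).1 (hall r (mem_strs.1 hr))).le
    rw [h1] at h2
    have h3 : k x * (3 * cnt (m x) fun b => χ (x, b) = true) ≤ k x * 2 ^ m x :=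
      Nat.mul_le_mul_left _ hLx
    have h4 : 0 < 2 ^ m x * k x := Nat.mul_pos (by positivity) (hk0 x)
    nlinarith

end PolyEq

theorem mainTheorem4 (h : PolyEq.CF = PolyEq.PEq) :
    PolyEq.NP = PolyEq.UP ∧ PolyEq.UP = PolyEq.RP ∧ PolyEq.PH = PolyEq.BPP := by
  open PolyEq in
  have h1 : NP ⊆ UP := NP_subset_UP h.ge
  have h2 : UP ⊆ RP := UP_subset_RP h.ge
  have h3 : NP ⊆ BPP := h1.trans (h2.trans RP_subset_BPP)
  exact ⟨h1.antisymm UP_subset_NP, h2.antisymm (RP_subset_NP.trans h1),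
    (Set.iUnion_subset (SigmaP_subset_BPP h3)).antisymm
      (BPP_subset_SigmaP_two.trans (Set.subset_iUnion SigmaP 2))⟩
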